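/- Let $n\ge 0$ and $m\ge 1$ be integers and let $w\in\mathbb C$ be a primitive $m$-th root of unity. Equip $\mathbb C^n$ (with coordinates $z_j=p_j+iq_j$) with $\lambda=\sum_j p_j\,dq_j$ and the symplectic form $\omega=d\lambda=\sum_j dp_j\wedge dq_j$. Let $K\subset\mathbb C^n$ be a compact, strictly convex set with non-empty interior (strictly convex: the open segment between any two distinct points of $K$ lies in the interior of $K$) whose boundary $\partial K$ is a $C^\infty$ hypersurface, and suppose that $wK=K$. A closed characteristic on $\partial K$ is a closed regular $C^1$ curve $\gamma:[0,T]\to\partial K$, $T>0$, $\gamma(0)=\gamma(T)$, $\dot\gamma\neq 0$ everywhere, such that for every $t$ the vector $\dot\gamma(t)$ lies in the kernel of the restriction of $\omega$ to the tangent space $T_{\gamma(t)}\partial K$; its action is $\left|\int_\gamma\lambda\right|$. Then every closed characteristic $\gamma$ on $\partial K$ whose action is minimal among all closed characteristics on $\partial K$ is invariant under multiplication by $w$: $w\,\gamma([0,T])=\gamma([0,T])$. -/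

import Mathlib

open Set
open scoped ContDiff Pointwise

/-- The standard symplectic form `ω = dλ = ∑ dpⱼ ∧ dqⱼ` on `ℂⁿ`, with `zⱼ = pⱼ + i qⱼ`. -/
def symplecticForm {n : ℕ} (u v : EuclideanSpace ℂ (Fin n)) : ℝ :=
  ∑ j, ((u j).re * (v j).im - (u j).im * (v j).re)

/-- `f` is a smooth local defining function of `K` at the point `x`: on an open neighbourhood `U`
of `x`, `f` is `C^∞` and `K` is given by `f ≤ 0`, and the differential of `f` at `x` is nonzero. -/
def IsDefiningFunctionAt {n : ℕ} (K : Set (EuclideanSpace ℂ (Fin n)))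
    (x : EuclideanSpace ℂ (Fin n)) (f : EuclideanSpace ℂ (Fin n) → ℝ) : Prop :=
  ∃ U : Set (EuclideanSpace ℂ (Fin n)), IsOpen U ∧ x ∈ U ∧ ContDiffOn ℝ ∞ f U ∧
    fderiv ℝ f x ≠ 0 ∧ ∀ y ∈ U, y ∈ K ↔ f y ≤ 0

/-- The boundary of `K` is a smooth real hypersurface with `K` locally on one side. -/
def HasSmoothBoundary {n : ℕ} (K : Set (EuclideanSpace ℂ (Fin n))) : Prop :=
  ∀ x ∈ frontier K, ∃ f : EuclideanSpace ℂ (Fin n) → ℝ, IsDefiningFunctionAt K x f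

/-- The tangent space of the boundary of `K` at a boundary point `x`: the kernel of the
differential of a local defining function (the kernel does not depend on that function). -/
def boundaryTangent {n : ℕ} (K : Set (EuclideanSpace ℂ (Fin n)))
    (x : EuclideanSpace ℂ (Fin n)) : Set (EuclideanSpace ℂ (Fin n)) :=
  {u | ∃ f : EuclideanSpace ℂ (Fin n) → ℝ, IsDefiningFunctionAt K x f ∧ fderiv ℝ f x u = 0}

/-- The kernel of the restriction of `ω` to the tangent space of the boundary of `K` at `x`. -/
def characteristicKernel {n : ℕ} (K : Set (EuclideanSpace ℂ (Fin n)))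
    (x : EuclideanSpace ℂ (Fin n)) : Set (EuclideanSpace ℂ (Fin n)) :=
  {v | v ∈ boundaryTangent K x ∧ ∀ u ∈ boundaryTangent K x, symplecticForm v u = 0}

/-- `γ : [0, T] → ∂K` (only the values on `[0, T]` matter) is a closed characteristic on `∂K`:
a closed regular `C^1` curve whose tangent vectors lie in the kernel of `ω` restricted to `∂K`. -/
structure IsClosedCharacteristic {n : ℕ} (K : Set (EuclideanSpace ℂ (Fin n)))
    (T : ℝ) (γ : ℝ → EuclideanSpace ℂ (Fin n)) : Prop where
  pos : 0 < T
  contDiffOn : ContDiffOn ℝ 1 γ (Icc 0 T)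
  closed : γ 0 = γ T
  mem_frontier : ∀ t ∈ Icc 0 T, γ t ∈ frontier K
  regular : ∀ t ∈ Icc 0 T, derivWithin γ (Icc 0 T) t ≠ 0
  tangent : ∀ t ∈ Icc 0 T, derivWithin γ (Icc 0 T) t ∈ characteristicKernel K (γ t)

/-- The action `∫ γ^* λ` of the curve `γ : [0, T] → ℂⁿ`, with `λ = ∑ pⱼ dqⱼ`. -/
noncomputable def action {n : ℕ} (T : ℝ) (γ : ℝ → EuclideanSpace ℂ (Fin n)) : ℝ :=
  ∫ t in (0 : ℝ)..T, ∑ j, (γ t j).re * (derivWithin γ (Icc 0 T) t j).im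

/-- `γ` is a closed characteristic of minimal action on `∂K`. A closed characteristic may be
traversed in either direction, which changes the sign of `∫ γ^* λ`; its action is the positive
one of the two values. -/
def IsMinimalClosedCharacteristic {n : ℕ} (K : Set (EuclideanSpace ℂ (Fin n)))
    (T : ℝ) (γ : ℝ → EuclideanSpace ℂ (Fin n)) : Prop :=
  IsClosedCharacteristic K T γ ∧
    ∀ (S : ℝ) (η : ℝ → EuclideanSpace ℂ (Fin n)),
      IsClosedCharacteristic K S η → |action T γ| ≤ |action S η|

open MeasureTheory Filter Topology

/-! Minimal closed characteristics are the extremals of a sharp isoperimetric inequality, and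
cutting and rotating an extremal produces further extremals.

Let `g` be the support function of `K` with respect to `ω`. Closed curves on `[0, 1]` with velocity
`v` satisfy `area v ≤ a * ∫ g(v)²` with an optimal `a > 0` that is attained (`exists_isoperimetric`:
convexity, weak compactness, and weak continuity of the area on bounded sets). The Euler–Lagrange
equation says that an extremal is, up to translation and dilation, a closed characteristic, of
action `1 / (4a)` (`exists_posLoop_of_extremal`). Conversely, a closed characteristic traversed on
`[0, 1]` with `g(v) = L` constant has action and area `L / 2` and energy `L²`, so `L ≥ 1 / (2a)`.
For a minimal one equality holds, so it is itself extremal.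

Let `w = exp(2πi/m)` and cut the extremal `ζ` into `m` pieces of equal duration. For each piece,
join its successive rotations by `1, w, ..., w^(m-1)`. The result closes up because the powers of
`w` sum to zero, and its energy is that of `ζ` because `wK = K`. The area of a curve is the area of
its chord polygon plus the areas between pieces and chords. The latter agree on average, and for the
former regular polygons are optimal: this is the discrete isoperimetric inequality, proved by
Fourier analysis on `ZMod m` (`polygon_symmetrization`). So the `m` new curves have on average at
least the area of `ζ`, hence all are extremal (`sum_area_rotatedPiece`). The Euler–Lagrange
equation, with one constant on both sides of the first junction, then forces `ζ (1/m) = w ζ 0`.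
Moving the starting point gives `ζ (t + 1/m) = w ζ t` for all `t`. Any other primitive root
generates the same group as `w`. -/

/-- The space `ℂⁿ` with its Euclidean norm. -/
abbrev CSpace (n : ℕ) := EuclideanSpace ℂ (Fin n)

/-! ### The symplectic form as the inner product twisted by `i` -/

/-- Multiplication by `i` as a real linear map. -/
noncomputable def mulI (n : ℕ) : CSpace n →L[ℝ] CSpace n :=
  (Complex.I • ContinuousLinearMap.id ℂ (CSpace n)).restrictScalars ℝ

/-- The symplectic form as a continuous bilinear map. -/
noncomputable def sympl {n : ℕ} : CSpace n →L[ℝ] CSpace n →L[ℝ] ℝ :=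
  (innerSL ℝ).comp (mulI n)

section Sympl

variable {n : ℕ}

lemma sympl_eq_inner (u v : CSpace n) : sympl u v = inner ℝ (Complex.I • u) v := rfl

lemma sympl_apply (u v : CSpace n) :
    sympl u v = ∑ j, ((u j).re * (v j).im - (u j).im * (v j).re) := by
  rw [sympl_eq_inner, PiLp.inner_apply]
  refine Finset.sum_congr rfl fun j _ => ?_
  simp [Complex.inner]
  ring

lemma sympl_eq_symplecticForm (u v : CSpace n) : sympl u v = symplecticForm u v :=
  sympl_apply u v

lemma sympl_swap (u v : CSpace n) : sympl u v = -sympl v u := by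
  rw [sympl_apply, sympl_apply, ← Finset.sum_neg_distrib]
  exact Finset.sum_congr rfl fun j _ => by ring

lemma sympl_self (v : CSpace n) : sympl v v = 0 := by
  have := sympl_swap v v
  linarith

lemma sympl_I_left (u v : CSpace n) : sympl (Complex.I • u) v = -inner ℝ u v := by
  rw [sympl_eq_inner, smul_smul, Complex.I_mul_I, neg_one_smul, inner_neg_left]

lemma sympl_I_right (u v : CSpace n) : sympl u (Complex.I • v) = inner ℝ u v := by
  rw [sympl_swap, sympl_I_left, neg_neg, real_inner_comm]

lemma sympl_I_self (v : CSpace n) : sympl v (Complex.I • v) = ‖v‖ ^ 2 := by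
  rw [sympl_I_right, real_inner_self_eq_norm_sq]

lemma abs_sympl_le (u v : CSpace n) : |sympl u v| ≤ ‖u‖ * ‖v‖ := by
  rw [sympl_eq_inner]
  refine (abs_real_inner_le_norm _ _).trans_eq ?_
  rw [norm_smul, Complex.norm_I, one_mul]

lemma sympl_le (u v : CSpace n) : sympl u v ≤ ‖u‖ * ‖v‖ :=
  (le_abs_self _).trans (abs_sympl_le u v)

lemma sympl_smul_smul {w : ℂ} (hw : ‖w‖ = 1) (u v : CSpace n) :
    sympl (w • u) (w • v) = sympl u v := by
  have h : w.re * w.re + w.im * w.im = 1 := by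
    have := Complex.sq_norm w
    rw [hw, Complex.normSq_apply] at this
    linarith
  rw [sympl_apply, sympl_apply]
  refine Finset.sum_congr rfl fun j _ => ?_
  simp only [PiLp.smul_apply, smul_eq_mul, Complex.mul_re, Complex.mul_im]
  linear_combination ((u j).re * (v j).im - (u j).im * (v j).re) * h

lemma eq_zero_of_sympl_right {u : CSpace n} (h : ∀ v, sympl u v = 0) : u = 0 := by
  have := h (Complex.I • u)
  rw [sympl_I_self] at this
  simpa using this

lemma eq_zero_of_sympl_left {v : CSpace n} (h : ∀ u, sympl u v = 0) : v = 0 :=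
  eq_zero_of_sympl_right fun u => by rw [sympl_swap, h, neg_zero]

end Sympl

/-! ### The symplectic support function and its gradient -/

/-- A compact strictly convex body containing the origin in its interior, with at most one
supporting direction at each point. -/
structure IsSmoothBody {n : ℕ} (K : Set (CSpace n)) : Prop where
  compact : IsCompact K
  strictConvex : StrictConvex ℝ K
  zero_mem : (0 : CSpace n) ∈ interior K
  unique_support : ∀ x ∈ K, ∀ u v : CSpace n, u ≠ 0 → v ≠ 0 → (∀ y ∈ K, sympl y u ≤ sympl x u) →
    (∀ y ∈ K, sympl y v ≤ sympl x v) → ∃ c : ℝ, 0 < c ∧ u = c • v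

open Classical in
/-- A point of `K` at which the functional `sympl · v` is maximal. -/
noncomputable def supportPt {n : ℕ} (K : Set (CSpace n)) (v : CSpace n) : CSpace n :=
  if h : ∃ x ∈ K, ∀ y ∈ K, sympl y v ≤ sympl x v then h.choose else 0

/-- The symplectic support function of `K`. -/
noncomputable def suppFun {n : ℕ} (K : Set (CSpace n)) (v : CSpace n) : ℝ :=
  sympl (supportPt K v) v

/-- Half of the symplectic gradient of `suppFun K ^ 2`. -/
noncomputable def suppGrad {n : ℕ} (K : Set (CSpace n)) (v : CSpace n) : CSpace n :=
  suppFun K v • supportPt K v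

namespace IsSmoothBody

variable {n : ℕ} {K : Set (CSpace n)}

section
variable (hK : IsSmoothBody K)
include hK

lemma exists_support (v : CSpace n) : ∃ x ∈ K, ∀ y ∈ K, sympl y v ≤ sympl x v := by
  obtain ⟨x, hx, h⟩ := hK.compact.exists_isMaxOn ⟨0, interior_subset hK.zero_mem⟩
    (f := fun y => sympl y v) (by fun_prop)
  exact ⟨x, hx, h⟩

lemma supportPt_mem (v : CSpace n) : supportPt K v ∈ K := by
  have h := hK.exists_support v
  rw [supportPt, dif_pos h]
  exact h.choose_spec.1

lemma le_suppFun (v : CSpace n) {y : CSpace n} (hy : y ∈ K) : sympl y v ≤ suppFun K v := by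
  have h := hK.exists_support v
  rw [suppFun, supportPt, dif_pos h]
  exact h.choose_spec.2 y hy

lemma exists_radii : ∃ r R : ℝ, 0 < r ∧ 0 < R ∧ Metric.closedBall 0 r ⊆ K ∧ ∀ x ∈ K, ‖x‖ ≤ R := by
  obtain ⟨r, hr, h⟩ := Metric.isOpen_iff.1 isOpen_interior 0 hK.zero_mem
  obtain ⟨R, hR, h'⟩ := hK.compact.isBounded.exists_pos_norm_le
  refine ⟨r / 2, R, by positivity, hR, ?_, h'⟩
  exact ((Metric.closedBall_subset_ball (by linarith)).trans h).trans interior_subset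

lemma suppFun_lower {r : ℝ} (hr : 0 < r) (h : Metric.closedBall 0 r ⊆ K) (v : CSpace n) :
    r * ‖v‖ ≤ suppFun K v := by
  rcases eq_or_ne v 0 with rfl | hv
  · simp [suppFun]
  have hv' : 0 < ‖v‖ := norm_pos_iff.2 hv
  have hmem : (r / ‖v‖) • (-(Complex.I • v)) ∈ K := by
    apply h
    rw [mem_closedBall_zero_iff, norm_smul, norm_neg, norm_smul, Complex.norm_I, one_mul,
      Real.norm_of_nonneg (by positivity)]
    exact (div_mul_cancel₀ _ hv'.ne').le
  have := hK.le_suppFun v hmem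
  rw [map_smul, map_neg, smul_apply, neg_apply,
    sympl_I_left, neg_neg, real_inner_self_eq_norm_sq, smul_eq_mul] at this
  calc r * ‖v‖ = r / ‖v‖ * ‖v‖ ^ 2 := by field_simp
    _ ≤ _ := this

lemma suppFun_nonneg (v : CSpace n) : 0 ≤ suppFun K v := by
  simpa using hK.le_suppFun v (interior_subset hK.zero_mem)

lemma suppFun_pos {v : CSpace n} (hv : v ≠ 0) : 0 < suppFun K v := by
  obtain ⟨r, R, hr, -, h, -⟩ := hK.exists_radii
  have := hK.suppFun_lower hr h v
  have : 0 < r * ‖v‖ := mul_pos hr (norm_pos_iff.2 hv)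
  linarith

omit hK in
lemma suppFun_zero : suppFun K (0 : CSpace n) = 0 := by simp [suppFun]

lemma suppFun_eq {x v : CSpace n} (hx : x ∈ K) (h : ∀ y ∈ K, sympl y v ≤ sympl x v) :
    suppFun K v = sympl x v :=
  le_antisymm (h _ (hK.supportPt_mem v)) (hK.le_suppFun v hx)

lemma suppFun_smul {s : ℝ} (hs : 0 ≤ s) (v : CSpace n) :
    suppFun K (s • v) = s * suppFun K v := by
  rw [hK.suppFun_eq (hK.supportPt_mem v) (v := s • v), map_smul, smul_eq_mul, suppFun]
  intro y hy
  rw [map_smul, map_smul, smul_eq_mul, smul_eq_mul]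
  exact mul_le_mul_of_nonneg_left (hK.le_suppFun v hy) hs

lemma suppFun_add_le (u v : CSpace n) : suppFun K (u + v) ≤ suppFun K u + suppFun K v := by
  have h1 := hK.le_suppFun u (hK.supportPt_mem (u + v))
  have h2 := hK.le_suppFun v (hK.supportPt_mem (u + v))
  rw [suppFun, map_add]
  linarith

lemma suppFun_sub_le {R : ℝ} (hR : ∀ x ∈ K, ‖x‖ ≤ R) (u v : CSpace n) :
    suppFun K u - suppFun K v ≤ R * ‖u - v‖ := by
  have h1 := hK.le_suppFun v (hK.supportPt_mem u)
  calc suppFun K u - suppFun K v ≤ sympl (supportPt K u) (u - v) := by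
        rw [map_sub]; unfold suppFun at *; linarith
    _ ≤ ‖supportPt K u‖ * ‖u - v‖ := sympl_le _ _
    _ ≤ _ := mul_le_mul_of_nonneg_right (hR _ (hK.supportPt_mem u)) (norm_nonneg _)

lemma suppFun_upper {R : ℝ} (hR : ∀ x ∈ K, ‖x‖ ≤ R) (v : CSpace n) : suppFun K v ≤ R * ‖v‖ := by
  simpa [suppFun_zero] using hK.suppFun_sub_le hR v 0

lemma exists_lipschitz : ∃ C : NNReal, LipschitzWith C (suppFun K) := by
  obtain ⟨r, R, hr, hR, -, h⟩ := hK.exists_radii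
  refine ⟨R.toNNReal, LipschitzWith.of_le_add_mul _ fun u v => ?_⟩
  have := hK.suppFun_sub_le h u v
  rw [dist_eq_norm, Real.coe_toNNReal R hR.le]
  linarith

lemma continuous_suppFun : Continuous (suppFun K) := by
  obtain ⟨C, hC⟩ := hK.exists_lipschitz
  exact hC.continuous

/-- By strict convexity the midpoint of two distinct maximizers would be interior. From there one
could move a little in the direction `-i v`, along which `sympl · v` strictly increases. -/
lemma supportPt_unique {x v : CSpace n} (hv : v ≠ 0) (hx : x ∈ K) (h : sympl x v = suppFun K v) :
    x = supportPt K v := by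
  by_contra hne
  have hmid := hK.strictConvex hx (hK.supportPt_mem v) hne (a := 1 / 2) (b := 1 / 2)
    (by norm_num) (by norm_num) (by norm_num)
  set z := (1 / 2 : ℝ) • x + (1 / 2 : ℝ) • supportPt K v with hz
  have hzv : sympl z v = suppFun K v := by
    rw [hz, map_add, map_smul, map_smul, add_apply,
      smul_apply, smul_apply, h, smul_eq_mul, smul_eq_mul,
      ← suppFun]
    ring
  obtain ⟨ε, hε, hball⟩ := Metric.isOpen_iff.1 isOpen_interior z hmid
  have hv' : 0 < ‖v‖ := norm_pos_iff.2 hv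
  have hmem : z + (ε / 2 / ‖v‖) • (-(Complex.I • v)) ∈ K := by
    apply interior_subset
    apply hball
    rw [Metric.mem_ball, dist_eq_norm, add_sub_cancel_left, norm_smul, norm_neg, norm_smul,
      Complex.norm_I, one_mul, Real.norm_of_nonneg (by positivity), div_mul_cancel₀ _ hv'.ne']
    linarith
  have := hK.le_suppFun v hmem
  rw [map_add, add_apply, hzv, map_smul, map_neg,
    smul_apply, neg_apply,
    sympl_I_left, neg_neg, real_inner_self_eq_norm_sq, smul_eq_mul] at this
  have : 0 < ε / 2 / ‖v‖ * ‖v‖ ^ 2 := by positivity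
  linarith

lemma norm_suppGrad_le {R : ℝ} (hR : ∀ x ∈ K, ‖x‖ ≤ R) (v : CSpace n) :
    ‖suppGrad K v‖ ≤ R ^ 2 * ‖v‖ := by
  have h1 := hK.suppFun_upper hR v
  have h2 := hR _ (hK.supportPt_mem v)
  have h3 := hK.suppFun_nonneg v
  rw [suppGrad, norm_smul, Real.norm_of_nonneg h3]
  calc _ ≤ (R * ‖v‖) * R := mul_le_mul h1 h2 (norm_nonneg _) (h3.trans h1)
    _ = _ := by ring

lemma le_norm_suppGrad {r : ℝ} (hr : 0 < r) (h : Metric.closedBall 0 r ⊆ K) (v : CSpace n) :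
    r ^ 2 * ‖v‖ ≤ ‖suppGrad K v‖ := by
  rcases eq_or_ne v 0 with rfl | hv
  · simp
  have hv' : 0 < ‖v‖ := norm_pos_iff.2 hv
  have h1 := hK.suppFun_lower hr h v
  have h2 : r ≤ ‖supportPt K v‖ := by
    have := h1.trans (sympl_le (supportPt K v) v)
    exact le_of_mul_le_mul_right this hv'
  rw [suppGrad, norm_smul, Real.norm_of_nonneg (hK.suppFun_nonneg v)]
  calc r ^ 2 * ‖v‖ = (r * ‖v‖) * r := by ring
    _ ≤ _ := mul_le_mul h1 h2 hr.le (hK.suppFun_nonneg v)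

/-- Along an ultrafilter converging to `v` the support points converge in the compact `K`. The limit
is again a maximizer for `v`, and the maximizer is unique. -/
lemma continuousAt_supportPt {v : CSpace n} (hv : v ≠ 0) : ContinuousAt (supportPt K) v := by
  rw [ContinuousAt, tendsto_iff_ultrafilter]
  intro l hl
  obtain ⟨x, hxK, hx⟩ := hK.compact.ultrafilter_le_nhds (l.map (supportPt K))
    (le_principal_iff.2 <| Ultrafilter.mem_coe.2 <| Ultrafilter.mem_map.2 <| by
      rw [show supportPt K ⁻¹' K = univ from eq_univ_of_forall hK.supportPt_mem]
      exact Filter.univ_mem)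
  have hx' : Tendsto (supportPt K) l (𝓝 x) := hx
  have h1 : Tendsto (fun u => sympl (supportPt K u) u) l (𝓝 (sympl x v)) := by
    have h : Tendsto (fun u => sympl (supportPt K u)) l (𝓝 (sympl x)) :=
      (sympl.continuous.tendsto x).comp hx'
    exact (isBoundedBilinearMap_apply.continuous.tendsto (sympl x, v)).comp (h.prodMk_nhds hl)
  have h2 : Tendsto (suppFun K) l (𝓝 (suppFun K v)) := (hK.continuous_suppFun.tendsto v).mono_left hl
  rw [← hK.supportPt_unique hv hxK (tendsto_nhds_unique h1 h2)]
  exact hx'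

lemma continuous_suppGrad : Continuous (suppGrad K) := by
  obtain ⟨r, R, hr, hR, -, h⟩ := hK.exists_radii
  rw [continuous_iff_continuousAt]
  intro v
  rcases eq_or_ne v 0 with rfl | hv
  -- The support point at `0` is an arbitrary choice, so continuity there rests on the linear growth
  -- bound.
  · have h0 : suppGrad K (0 : CSpace n) = 0 := by simp [suppGrad, suppFun_zero]
    rw [ContinuousAt, h0]
    refine squeeze_zero_norm (hK.norm_suppGrad_le h) ?_
    have : Continuous fun v : CSpace n => R ^ 2 * ‖v‖ := by fun_prop
    simpa using this.tendsto 0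
  · exact hK.continuous_suppFun.continuousAt.smul (hK.continuousAt_supportPt hv)

lemma sympl_supportPt_le (u v : CSpace n) : sympl (supportPt K u) v ≤ suppFun K v :=
  hK.le_suppFun v (hK.supportPt_mem u)

/-- The subgradient inequality for the convex function `suppFun K ^ 2`, reduced to `2xy ≤ x² + y²`.
It replaces differentiation of the energy later on. -/
lemma two_sympl_suppGrad_le (u v : CSpace n) :
    2 * sympl (suppGrad K u) (v - u) ≤ suppFun K v ^ 2 - suppFun K u ^ 2 := by
  have h1 := hK.sympl_supportPt_le u v
  have h2 := hK.suppFun_nonneg u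
  have h3 : sympl (suppGrad K u) (v - u)
      = suppFun K u * sympl (supportPt K u) v - suppFun K u ^ 2 := by
    rw [suppGrad, map_sub, map_smul, smul_apply,
      smul_apply, ← suppFun, smul_eq_mul, smul_eq_mul]
    ring
  rw [h3]
  nlinarith [mul_le_mul_of_nonneg_left h1 h2, sq_nonneg (suppFun K v - suppFun K u)]

/-- Testing a common gradient against both vectors shows that the support functions agree, hence so
do the support points. Uniqueness of the supporting direction makes the vectors proportional, and
homogeneity makes the factor `1`. This is the only use of `unique_support`. -/
lemma injective_suppGrad : Function.Injective (suppGrad K) := by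
  obtain ⟨r, R, hr, hR, hball, -⟩ := hK.exists_radii
  have key : ∀ u v : CSpace n, v ≠ 0 → suppGrad K u = suppGrad K v → suppFun K v ≤ suppFun K u := by
    intro u v hv h
    have hg := hK.suppFun_pos hv
    have h1 := congrArg (fun z => sympl z v) h
    simp only [suppGrad, map_smul, smul_apply, smul_eq_mul] at h1
    rw [← suppFun] at h1
    have h2 := mul_le_mul_of_nonneg_left (hK.sympl_supportPt_le u v) (hK.suppFun_nonneg u)
    rw [h1] at h2
    exact le_of_mul_le_mul_right h2 hg
  have hzero : ∀ v : CSpace n, suppGrad K v = 0 → v = 0 := by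
    intro v h
    have := hK.le_norm_suppGrad hr hball v
    rw [h, norm_zero] at this
    have h3 : ‖v‖ ≤ 0 := le_of_mul_le_mul_left (by simpa using this) (pow_pos hr 2)
    exact norm_le_zero_iff.1 h3
  have hz0 : suppGrad K (0 : CSpace n) = 0 := by simp [suppGrad, suppFun_zero]
  intro u v h
  rcases eq_or_ne v 0 with rfl | hv
  · exact hzero u (h.trans hz0)
  rcases eq_or_ne u 0 with rfl | hu
  · exact (hzero v (h.symm.trans hz0)).symm
  have hg : suppFun K u = suppFun K v := le_antisymm (key v u hu h.symm) (key u v hv h)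
  have hpt : supportPt K u = supportPt K v := by
    rw [suppGrad, suppGrad, hg] at h
    exact smul_right_injective _ (hK.suppFun_pos hv).ne' h
  obtain ⟨c, hc, rfl⟩ := hK.unique_support (supportPt K v) (hK.supportPt_mem v) u v hu hv
    (fun y hy => by rw [← hpt]; exact hK.le_suppFun u hy) (fun y hy => hK.le_suppFun v hy)
  rw [hK.suppFun_smul hc.le] at hg
  have : c = 1 := by
    have := (hK.suppFun_pos hv).ne'
    exact mul_right_cancel₀ this (by rw [hg, one_mul])
  rw [this, one_smul]

/-- Linear growth from below makes the injective continuous map proper. A velocity can therefore be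
recovered continuously from its gradient, which gives regularity of extremals. -/
lemma isClosedEmbedding_suppGrad : IsClosedEmbedding (suppGrad K) := by
  obtain ⟨r, R, hr, hR, hball, -⟩ := hK.exists_radii
  refine IsClosedEmbedding.of_continuous_injective_isClosedMap hK.continuous_suppGrad
    hK.injective_suppGrad ?_
  refine (isProperMap_iff_tendsto_cocompact.2 ⟨hK.continuous_suppGrad, ?_⟩).isClosedMap
  rw [← Metric.cobounded_eq_cocompact, ← tendsto_norm_atTop_iff_cobounded]
  refine tendsto_atTop_mono (hK.le_norm_suppGrad hr hball) ?_
  exact tendsto_norm_cobounded_atTop.const_mul_atTop (pow_pos hr 2)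

/-- Symmetry of the support function under a unit complex number preserving `K`. -/
lemma suppFun_unit_smul {w : ℂ} (hw : ‖w‖ = 1) (hwK : w • K = K) (v : CSpace n) :
    suppFun K (w • v) = suppFun K v := by
  rw [hK.suppFun_eq (x := w • supportPt K v) (v := w • v), sympl_smul_smul hw, suppFun]
  · have := smul_mem_smul_set (a := w) (hK.supportPt_mem v)
    rwa [hwK] at this
  · intro y hy
    rw [← hwK] at hy
    obtain ⟨z, hz, rfl⟩ := hy
    simp only [sympl_smul_smul hw]
    exact hK.le_suppFun v hz

lemma supportPt_unit_smul {w : ℂ} (hw : ‖w‖ = 1) (hwK : w • K = K) {v : CSpace n} (hv : v ≠ 0) :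
    supportPt K (w • v) = w • supportPt K v := by
  have hw0 : w ≠ 0 := by rintro rfl; simp at hw
  refine (hK.supportPt_unique (smul_ne_zero hw0 hv) ?_ ?_).symm
  · have := smul_mem_smul_set (a := w) (hK.supportPt_mem v)
    rwa [hwK] at this
  · rw [sympl_smul_smul hw, hK.suppFun_unit_smul hw hwK, suppFun]

lemma suppGrad_unit_smul {w : ℂ} (hw : ‖w‖ = 1) (hwK : w • K = K) (v : CSpace n) :
    suppGrad K (w • v) = w • suppGrad K v := by
  rcases eq_or_ne v 0 with rfl | hv
  · simp [suppGrad, suppFun_zero]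
  · rw [suppGrad, hK.suppFun_unit_smul hw hwK, hK.supportPt_unit_smul hw hwK hv, suppGrad,
      smul_comm]

end

end IsSmoothBody

/-! ### Symplectic area of curves with integrable velocity -/

/-- The integral of `sympl U v` where `U` is the primitive of `u` vanishing at `a`. -/
noncomputable def crossInt {n : ℕ} (a b : ℝ) (u v : ℝ → CSpace n) : ℝ :=
  ∫ t in a..b, sympl (∫ s in a..t, u s) (v t)

/-- The symplectic area between a curve with velocity `v` and its chord. -/
noncomputable def area {n : ℕ} (a b : ℝ) (v : ℝ → CSpace n) : ℝ :=
  crossInt a b v v / 2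

section Area

variable {n : ℕ} {a b c : ℝ} {u v φ : ℝ → CSpace n}

lemma continuousOn_primitive_uIcc (hu : IntervalIntegrable u volume a b) :
    ContinuousOn (fun t => ∫ s in a..t, u s) (uIcc a b) :=
  intervalIntegral.continuousOn_primitive_interval' hu left_mem_uIcc

lemma IntervalIntegrable.sympl_continuousOn_left {p : ℝ → CSpace n}
    (hp : ContinuousOn p (uIcc a b)) (hv : IntervalIntegrable v volume a b) :
    IntervalIntegrable (fun t => sympl (p t) (v t)) volume a b := by
  obtain ⟨C, hC⟩ := isCompact_uIcc.exists_bound_of_continuousOn hp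
  rw [intervalIntegrable_iff] at hv ⊢
  refine ContinuousLinearMap.integrable_of_bilin_of_bdd_left sympl C ?_ ?_ hv
  · exact (hp.mono uIoc_subset_uIcc).aestronglyMeasurable measurableSet_uIoc
  · exact (ae_restrict_iff' measurableSet_uIoc).2 (ae_of_all _ fun t ht =>
      hC t (uIoc_subset_uIcc ht))

lemma intervalIntegrable_cross (hu : IntervalIntegrable u volume a b)
    (hv : IntervalIntegrable v volume a b) :
    IntervalIntegrable (fun t => sympl (∫ s in a..t, u s) (v t)) volume a b :=
  hv.sympl_continuousOn_left (continuousOn_primitive_uIcc hu)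

/-- Integration by parts for merely integrable functions: their primitives are absolutely continuous
and have the expected derivatives almost everywhere. -/
lemma integral_primitive_mul_add {f g : ℝ → ℝ} (hf : IntervalIntegrable f volume a b)
    (hg : IntervalIntegrable g volume a b) :
    (∫ t in a..b, (∫ s in a..t, f s) * g t) + ∫ t in a..b, f t * (∫ s in a..t, g s)
      = (∫ s in a..b, f s) * ∫ s in a..b, g s := by
  have hF := hf.absolutelyContinuousOnInterval_intervalIntegral (c := a) left_mem_uIcc
  have hG := hg.absolutelyContinuousOnInterval_intervalIntegral (c := a) left_mem_uIcc
  have h := hF.integral_mul_deriv_eq_deriv_mul hG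
  have h1 : ∫ t in a..b, (∫ s in a..t, f s) * deriv (fun t => ∫ s in a..t, g s) t
      = ∫ t in a..b, (∫ s in a..t, f s) * g t := by
    apply intervalIntegral.integral_congr_ae
    filter_upwards [hg.ae_hasDerivAt_integral] with t ht hmem
    rw [(ht (uIoc_subset_uIcc hmem) a left_mem_uIcc).deriv]
  have h2 : ∫ t in a..b, deriv (fun t => ∫ s in a..t, f s) t * (∫ s in a..t, g s)
      = ∫ t in a..b, f t * (∫ s in a..t, g s) := by
    apply intervalIntegral.integral_congr_ae
    filter_upwards [hf.ae_hasDerivAt_integral] with t ht hmem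
    rw [(ht (uIoc_subset_uIcc hmem) a left_mem_uIcc).deriv]
  rw [h1, h2] at h
  simp only [intervalIntegral.integral_same, mul_zero, sub_zero] at h
  linarith

/-- Real part of the `j`-th coordinate. -/
noncomputable def reCoord (j : Fin n) : CSpace n →L[ℝ] ℝ :=
  Complex.reCLM.comp ((EuclideanSpace.proj j : CSpace n →L[ℂ] ℂ).restrictScalars ℝ)

/-- Imaginary part of the `j`-th coordinate. -/
noncomputable def imCoord (j : Fin n) : CSpace n →L[ℝ] ℝ :=
  Complex.imCLM.comp ((EuclideanSpace.proj j : CSpace n →L[ℂ] ℂ).restrictScalars ℝ)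

lemma sympl_eq_sum_coord (u v : CSpace n) :
    sympl u v = ∑ j, (reCoord j u * imCoord j v - imCoord j u * reCoord j v) :=
  sympl_apply u v

lemma integral_functional_primitive_mul_add (L M : CSpace n →L[ℝ] ℝ)
    (hu : IntervalIntegrable u volume a b) (hv : IntervalIntegrable v volume a b) :
    (∫ t in a..b, L (∫ s in a..t, u s) * M (v t)) + ∫ t in a..b, L (u t) * M (∫ s in a..t, v s)
      = L (∫ s in a..b, u s) * M (∫ s in a..b, v s) := by
  have hLu : IntervalIntegrable (fun t => L (u t)) volume a b :=
    ⟨L.integrable_comp hu.1, L.integrable_comp hu.2⟩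
  have hMv : IntervalIntegrable (fun t => M (v t)) volume a b :=
    ⟨M.integrable_comp hv.1, M.integrable_comp hv.2⟩
  rw [← L.intervalIntegral_comp_comm hu, ← M.intervalIntegral_comp_comm hv,
    ← integral_primitive_mul_add hLu hMv]
  congr 1
  · apply intervalIntegral.integral_congr
    intro t ht
    simp only
    rw [← L.intervalIntegral_comp_comm (hu.mono_set (uIcc_subset_uIcc_left ht))]
  · apply intervalIntegral.integral_congr
    intro t ht
    simp only
    rw [← M.intervalIntegral_comp_comm (hv.mono_set (uIcc_subset_uIcc_left ht))]

lemma intervalIntegrable_functional_mul_left (L M : CSpace n →L[ℝ] ℝ)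
    (hu : IntervalIntegrable u volume a b) (hv : IntervalIntegrable v volume a b) :
    IntervalIntegrable (fun t => L (∫ s in a..t, u s) * M (v t)) volume a b := by
  have hMv : IntervalIntegrable (fun t => M (v t)) volume a b :=
    ⟨M.integrable_comp hv.1, M.integrable_comp hv.2⟩
  exact hMv.continuousOn_mul (L.continuous.comp_continuousOn (continuousOn_primitive_uIcc hu))

lemma intervalIntegrable_functional_mul_right (L M : CSpace n →L[ℝ] ℝ)
    (hu : IntervalIntegrable u volume a b) (hv : IntervalIntegrable v volume a b) :
    IntervalIntegrable (fun t => L (u t) * M (∫ s in a..t, v s)) volume a b := by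
  simpa only [mul_comm] using intervalIntegrable_functional_mul_left M L hv hu

lemma crossInt_add_integral (hu : IntervalIntegrable u volume a b)
    (hv : IntervalIntegrable v volume a b) :
    crossInt a b u v + ∫ t in a..b, sympl (u t) (∫ s in a..t, v s)
      = sympl (∫ s in a..b, u s) (∫ s in a..b, v s) := by
  rw [crossInt]
  simp only [sympl_eq_sum_coord]
  rw [intervalIntegral.integral_finsetSum, intervalIntegral.integral_finsetSum,
    ← Finset.sum_add_distrib]
  · refine Finset.sum_congr rfl fun j _ => ?_
    rw [intervalIntegral.integral_sub, intervalIntegral.integral_sub,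
      ← integral_functional_primitive_mul_add _ _ hu hv,
      ← integral_functional_primitive_mul_add _ _ hu hv]
    · ring
    all_goals first
      | exact intervalIntegrable_functional_mul_left _ _ hu hv
      | exact intervalIntegrable_functional_mul_right _ _ hu hv
  · intro j _
    exact (intervalIntegrable_functional_mul_right _ _ hu hv).sub
      (intervalIntegrable_functional_mul_right _ _ hu hv)
  · intro j _
    exact (intervalIntegrable_functional_mul_left _ _ hu hv).sub
      (intervalIntegrable_functional_mul_left _ _ hu hv)

/-- The antisymmetric part of `crossInt` sees only the chords, so the form is symmetric as soon as
one of the curves is closed. -/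
lemma crossInt_sub_swap (hu : IntervalIntegrable u volume a b)
    (hv : IntervalIntegrable v volume a b) :
    crossInt a b u v - crossInt a b v u = sympl (∫ s in a..b, u s) (∫ s in a..b, v s) := by
  rw [← crossInt_add_integral hu hv, sub_eq_add_neg, crossInt, crossInt,
    ← intervalIntegral.integral_neg]
  congr 2
  ext t
  rw [sympl_swap, neg_neg]

lemma crossInt_add_right (hu : IntervalIntegrable u volume a b)
    (hv : IntervalIntegrable v volume a b) (hφ : IntervalIntegrable φ volume a b) :
    crossInt a b u (fun t => v t + φ t) = crossInt a b u v + crossInt a b u φ := by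
  simp only [crossInt, map_add]
  exact intervalIntegral.integral_add (intervalIntegrable_cross hu hv)
    (intervalIntegrable_cross hu hφ)

lemma crossInt_smul_right (r : ℝ) (u v : ℝ → CSpace n) :
    crossInt a b u (fun t => r • v t) = r * crossInt a b u v := by
  simp only [crossInt, map_smul, smul_eq_mul]
  exact intervalIntegral.integral_const_mul _ _

lemma crossInt_add_left (hu : IntervalIntegrable u volume a b)
    (hφ : IntervalIntegrable φ volume a b) (hv : IntervalIntegrable v volume a b) :
    crossInt a b (fun t => u t + φ t) v = crossInt a b u v + crossInt a b φ v := by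
  rw [crossInt, crossInt, crossInt, ← intervalIntegral.integral_add
    (intervalIntegrable_cross hu hv) (intervalIntegrable_cross hφ hv)]
  apply intervalIntegral.integral_congr
  intro t ht
  simp only
  rw [intervalIntegral.integral_add (hu.mono_set (uIcc_subset_uIcc_left ht))
    (hφ.mono_set (uIcc_subset_uIcc_left ht)), map_add, add_apply]

lemma crossInt_smul_left (r : ℝ) (u v : ℝ → CSpace n) :
    crossInt a b (fun t => r • u t) v = r * crossInt a b u v := by
  simp only [crossInt, intervalIntegral.integral_smul, map_smul, smul_apply, smul_eq_mul]
  exact intervalIntegral.integral_const_mul _ _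

lemma area_smul (r : ℝ) (v : ℝ → CSpace n) :
    area a b (fun t => r • v t) = r ^ 2 * area a b v := by
  rw [area, crossInt_smul_left, crossInt_smul_right, area]
  ring

/-- Expansion of the area along a variation that keeps the endpoints. -/
lemma area_add_smul (hv : IntervalIntegrable v volume a b) (hφ : IntervalIntegrable φ volume a b)
    (h0 : ∫ t in a..b, φ t = 0) (ε : ℝ) :
    area a b (fun t => v t + ε • φ t)
      = area a b v + ε * crossInt a b v φ + ε ^ 2 * area a b φ := by
  have hεφ : IntervalIntegrable (fun t => ε • φ t) volume a b := hφ.smul ε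
  have h := crossInt_sub_swap hv hφ
  rw [h0, map_zero] at h
  rw [area, crossInt_add_left hv hεφ (hv.add hεφ), crossInt_add_right hv hv hεφ,
    crossInt_add_right hεφ hv hεφ, crossInt_smul_left, crossInt_smul_left, crossInt_smul_right,
    crossInt_smul_right, area, area]
  linear_combination (-ε / 2) * h

/-- Concatenation adds the areas of the two pieces and that of the triangle spanned by their chords.
-/
lemma area_add (hab : IntervalIntegrable v volume a b) (hbc : IntervalIntegrable v volume b c) :
    area a c v = area a b v + area b c v
      + sympl (∫ s in a..b, v s) (∫ s in b..c, v s) / 2 := by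
  have hac := hab.trans hbc
  have h1 : ∫ t in b..c, sympl (∫ s in a..t, v s) (v t)
      = sympl (∫ s in a..b, v s) (∫ s in b..c, v s) + crossInt b c v v := by
    have hc : IntervalIntegrable (fun t => sympl (∫ s in a..b, v s) (v t)) volume b c :=
      ⟨(sympl _).integrable_comp hbc.1, (sympl _).integrable_comp hbc.2⟩
    rw [← (sympl _).intervalIntegral_comp_comm hbc, crossInt, ← intervalIntegral.integral_add hc
      (intervalIntegrable_cross hbc hbc)]
    apply intervalIntegral.integral_congr
    intro t ht
    simp only
    rw [← intervalIntegral.integral_add_adjacent_intervals hab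
      (hbc.mono_set (uIcc_subset_uIcc_left ht)), map_add, add_apply]
  have h2 : IntervalIntegrable (fun t => sympl (∫ s in a..t, v s) (v t)) volume b c := by
    have h3 : ContinuousOn (fun t => (∫ s in a..b, v s) + ∫ s in b..t, v s) (uIcc b c) :=
      continuousOn_const.add (continuousOn_primitive_uIcc hbc)
    refine hbc.sympl_continuousOn_left (h3.congr fun t ht => ?_)
    rw [← intervalIntegral.integral_add_adjacent_intervals hab
      (hbc.mono_set (uIcc_subset_uIcc_left ht))]
  rw [area, area, area, crossInt, ← intervalIntegral.integral_add_adjacent_intervals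
    (intervalIntegrable_cross hab hab) h2, h1, ← crossInt]
  ring

/-- Decomposition of the area along a partition. -/
lemma area_eq_sum (hv : ∀ a b, IntervalIntegrable v volume a b) (t : ℕ → ℝ) (m : ℕ) :
    area (t 0) (t m) v = ∑ j ∈ Finset.range m, area (t j) (t (j + 1)) v
      + (∑ j ∈ Finset.range m,
        sympl (∑ k ∈ Finset.range j, ∫ s in t k..t (k + 1), v s)
          (∫ s in t j..t (j + 1), v s)) / 2 := by
  induction m with
  | zero => simp [area, crossInt]
  | succ m ih =>
    rw [area_add (hv _ (t m)) (hv _ _), ih, Finset.sum_range_succ, Finset.sum_range_succ,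
      intervalIntegral.sum_integral_adjacent_intervals fun k _ => hv _ _]
    ring

lemma area_congr (hab : a ≤ b) (h : ∀ᵐ t, t ∈ Ioc a b → u t = v t) :
    area a b u = area a b v := by
  rw [area, area, crossInt, crossInt]
  congr 1
  apply intervalIntegral.integral_congr_ae
  filter_upwards [h] with t ht hmem
  rw [uIoc_of_le hab] at hmem
  rw [ht hmem]
  congr 2
  apply intervalIntegral.integral_congr_ae
  filter_upwards [h] with s hs hsmem
  rw [uIoc_of_le hmem.1.le] at hsmem
  exact hs ⟨hsmem.1, hsmem.2.trans hmem.2⟩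

lemma area_comp_add_right (h : ℝ) (v : ℝ → CSpace n) :
    area a b (fun t => v (t + h)) = area (a + h) (b + h) v := by
  rw [area, area, crossInt, crossInt, ← intervalIntegral.integral_comp_add_right]
  congr 2
  ext t
  rw [intervalIntegral.integral_comp_add_right]

lemma area_unit_smul {w : ℂ} (hw : ‖w‖ = 1) (v : ℝ → CSpace n) :
    area a b (fun t => w • v t) = area a b v := by
  rw [area, area, crossInt, crossInt]
  simp only [intervalIntegral.integral_smul, sympl_smul_smul hw]

/-- Cauchy–Schwarz, read off from the nonnegative variance of `‖v‖` around its mean `c`. -/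
lemma sq_integral_norm_le (hab : a ≤ b) (hv : IntervalIntegrable v volume a b)
    (hv2 : IntervalIntegrable (fun t => ‖v t‖ ^ 2) volume a b) :
    (∫ t in a..b, ‖v t‖) ^ 2 ≤ (b - a) * ∫ t in a..b, ‖v t‖ ^ 2 := by
  rcases hab.eq_or_lt with rfl | hlt
  · simp
  set I := ∫ t in a..b, ‖v t‖
  set c := I / (b - a)
  have hba : 0 < b - a := sub_pos.2 hlt
  have h0 : 0 ≤ ∫ t in a..b, (‖v t‖ - c) ^ 2 :=
    intervalIntegral.integral_nonneg hab fun t _ => sq_nonneg _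
  have h1 : ∫ t in a..b, (‖v t‖ - c) ^ 2
      = (∫ t in a..b, ‖v t‖ ^ 2) - 2 * c * I + c ^ 2 * (b - a) := by
    have : (fun t => (‖v t‖ - c) ^ 2) = fun t => ‖v t‖ ^ 2 - 2 * c * ‖v t‖ + c ^ 2 := by
      ext t; ring
    rw [this, intervalIntegral.integral_add (hv2.sub (hv.norm.const_mul _))
      intervalIntegrable_const, intervalIntegral.integral_sub hv2 (hv.norm.const_mul _),
      intervalIntegral.integral_const_mul, intervalIntegral.integral_const, smul_eq_mul]
    ring
  have h2 : c * (b - a) = I := div_mul_cancel₀ _ hba.ne'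
  rw [h1] at h0
  have h3 : 0 ≤ (b - a) * ((∫ t in a..b, ‖v t‖ ^ 2) - 2 * c * I + c ^ 2 * (b - a)) :=
    mul_nonneg hba.le h0
  have h4 : (b - a) * ((∫ t in a..b, ‖v t‖ ^ 2) - 2 * c * I + c ^ 2 * (b - a))
      = (b - a) * (∫ t in a..b, ‖v t‖ ^ 2) - I ^ 2 := by
    rw [← h2]; ring
  linarith

/-- The factor `b - a` is what matters: over `N` pieces of length `1 / N` the areas sum to at most
`1 / N` times the squared `L²` norm. -/
lemma abs_area_le (hab : a ≤ b) (hv : IntervalIntegrable v volume a b)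
    (hv2 : IntervalIntegrable (fun t => ‖v t‖ ^ 2) volume a b) :
    |area a b v| ≤ (b - a) * ∫ t in a..b, ‖v t‖ ^ 2 := by
  refine le_trans ?_ (sq_integral_norm_le hab hv hv2)
  have h1 : |crossInt a b v v| ≤ ∫ t in a..b, (∫ s in a..b, ‖v s‖) * ‖v t‖ := by
    rw [← Real.norm_eq_abs, crossInt]
    refine intervalIntegral.norm_integral_le_of_norm_le hab ?_ (hv.norm.const_mul _)
    refine ae_of_all _ fun t ht => (abs_sympl_le _ _).trans ?_
    refine mul_le_mul_of_nonneg_right ?_ (norm_nonneg _)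
    refine (intervalIntegral.norm_integral_le_integral_norm ht.1.le).trans ?_
    exact intervalIntegral.integral_mono_interval le_rfl ht.1.le ht.2
      (ae_of_all _ fun s => norm_nonneg _) hv.norm
  rw [intervalIntegral.integral_const_mul] at h1
  rw [area, abs_div, abs_two]
  nlinarith [sq_nonneg (∫ t in a..b, ‖v t‖)]

end Area

/-! ### Maxima of weakly continuous functions on Hilbert space -/

section WeakMax

variable {H : Type*} [NormedAddCommGroup H] [InnerProductSpace ℝ H] [CompleteSpace H]

/-- The vector representing a functional in the weak dual of a Hilbert space. -/
noncomputable def weakRep (φ : WeakDual ℝ H) : H :=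
  (InnerProductSpace.toDual ℝ H).symm (WeakDual.toStrongDual φ)

lemma inner_weakRep (φ : WeakDual ℝ H) (y : H) : inner ℝ (weakRep φ) y = φ y :=
  InnerProductSpace.toDual_symm_apply

lemma continuous_inner_weakRep (y : H) : Continuous fun φ : WeakDual ℝ H => inner ℝ y (weakRep φ) := by
  have h : (fun φ : WeakDual ℝ H => inner ℝ y (weakRep φ)) = fun φ => φ y := by
    ext φ
    rw [real_inner_comm, inner_weakRep]
  rw [h]
  exact WeakDual.eval_continuous y

lemma weakRep_surjective : Function.Surjective (weakRep : WeakDual ℝ H → H) := fun x =>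
  ⟨StrongDual.toWeakDual (InnerProductSpace.toDual ℝ H x), by simp [weakRep]⟩

/-- Banach–Alaoglu; weak closedness of a closed convex set comes from Hahn–Banach separation. -/
lemma isCompact_preimage_weakRep {B : Set H} (hc : IsClosed B) (hconv : Convex ℝ B)
    (hb : Bornology.IsBounded B) : IsCompact (weakRep ⁻¹' B : Set (WeakDual ℝ H)) := by
  apply WeakDual.isCompact_of_bounded_of_closed
  · obtain ⟨R, hR⟩ := hb.exists_norm_le
    have h : weakRep ⁻¹' B ⊆ WeakDual.toStrongDual ⁻¹' Metric.closedBall (0 : StrongDual ℝ H) R := by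
      intro φ hφ
      have := hR _ hφ
      rw [weakRep, LinearIsometryEquiv.norm_map] at this
      simpa using this
    exact Bornology.IsBounded.subset (WeakDual.isBounded_closedBall _ _) h
  · rw [isClosed_iff_clusterPt]
    intro φ hφ
    by_contra hn
    obtain ⟨f, u, h1, h2⟩ := geometric_hahn_banach_closed_point hconv hc hn
    have hcont : Continuous fun ψ : WeakDual ℝ H => f (weakRep ψ) := by
      have := continuous_inner_weakRep ((InnerProductSpace.toDual ℝ H).symm f)
      simpa only [InnerProductSpace.toDual_symm_apply] using this
    have hcl : IsClosed {ψ : WeakDual ℝ H | f (weakRep ψ) ≤ u} :=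
      isClosed_le hcont continuous_const
    have hmem : φ ∈ {ψ : WeakDual ℝ H | f (weakRep ψ) ≤ u} :=
      (isClosed_iff_clusterPt.1 hcl) φ
        (hφ.mono (principal_mono.2 fun ψ hψ => (h1 _ hψ).le))
    exact absurd h2 (not_lt.2 hmem)

/-- A uniform limit of weakly continuous functions attains its maximum on a bounded closed convex
subset of a Hilbert space. -/
theorem exists_isMaxOn_of_tendstoUniformlyOn {B : Set H} (hc : IsClosed B) (hconv : Convex ℝ B)
    (hb : Bornology.IsBounded B) (hne : B.Nonempty) {F : H → ℝ} {G : ℕ → H → ℝ}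
    (hG : ∀ N, Continuous fun φ : WeakDual ℝ H => G N (weakRep φ))
    (hlim : TendstoUniformlyOn G F atTop B) : ∃ x ∈ B, ∀ y ∈ B, F y ≤ F x := by
  have hcomp := isCompact_preimage_weakRep hc hconv hb
  have hcont : ContinuousOn (fun φ : WeakDual ℝ H => F (weakRep φ)) (weakRep ⁻¹' B) :=
    (hlim.comp weakRep).continuousOn (Frequently.of_forall fun N => (hG N).continuousOn)
  obtain ⟨φ, hφ, hmax⟩ := hcomp.exists_isMaxOn (hne.preimage weakRep_surjective) hcont
  refine ⟨weakRep φ, hφ, fun y hy => ?_⟩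
  obtain ⟨ψ, rfl⟩ := weakRep_surjective y
  exact hmax hy

end WeakMax

/-! ### Existence of extremals for the isoperimetric inequality -/

/-- Lebesgue measure on the unit interval. -/
noncomputable abbrev unitVol : Measure ℝ := volume.restrict (Ioc 0 1)

/-- The integral over the unit interval of the squared support function of the velocity. -/
noncomputable def energy {n : ℕ} (K : Set (CSpace n)) (v : ℝ → CSpace n) : ℝ :=
  ∫ t in (0 : ℝ)..1, suppFun K (v t) ^ 2

section UnitInterval

variable {n : ℕ} {K : Set (CSpace n)} {v : ℝ → CSpace n}

lemma intervalIntegrable_of_memLp (hv : MemLp v 2 unitVol) : IntervalIntegrable v volume 0 1 :=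
  (intervalIntegrable_iff_integrableOn_Ioc_of_le zero_le_one).2 (hv.integrable one_le_two)

lemma intervalIntegrable_sq_of_memLp (hv : MemLp v 2 unitVol) :
    IntervalIntegrable (fun t => ‖v t‖ ^ 2) volume 0 1 :=
  (intervalIntegrable_iff_integrableOn_Ioc_of_le zero_le_one).2
    ((memLp_two_iff_integrable_sq_norm hv.1).1 hv)

lemma intervalIntegrable_indicator (hv : MemLp v 2 unitVol) (a b : ℝ) :
    IntervalIntegrable ((Ioc 0 1).indicator v) volume a b :=
  ((integrable_indicator_iff measurableSet_Ioc).2 (hv.integrable one_le_two)).intervalIntegrable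

lemma integral_indicator_eq {a b : ℝ} (hab : a ≤ b) (v : ℝ → CSpace n) :
    ∫ t in a..b, (Ioc 0 1).indicator v t = ∫ t in Ioc a b, v t ∂unitVol := by
  rw [intervalIntegral.integral_of_le hab, setIntegral_indicator measurableSet_Ioc,
    Measure.restrict_restrict measurableSet_Ioc]

/-- The quantity is the inner product with an indicator function times a constant vector, hence
weakly continuous. -/
lemma continuous_inner_setIntegral_weakRep {a b : ℝ} (L : CSpace n →L[ℝ] ℝ) :
    Continuous fun φ : WeakDual ℝ (Lp (CSpace n) 2 unitVol) =>
      L (∫ t in Ioc a b, (weakRep φ : Lp (CSpace n) 2 unitVol) t ∂unitVol) := by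
  set c := (InnerProductSpace.toDual ℝ (CSpace n)).symm L with hc
  have h := continuous_inner_weakRep (indicatorConstLp 2 (measurableSet_Ioc (a := a) (b := b))
    (measure_ne_top unitVol _) c)
  simp_rw [L2.inner_indicatorConstLp_eq_inner_setIntegral] at h
  simpa only [hc, InnerProductSpace.toDual_symm_apply] using h

/-- The area of the polygon inscribed in a curve on the unit interval. -/
noncomputable def polygonArea (N : ℕ) (v : ℝ → CSpace n) : ℝ :=
  (∑ j ∈ Finset.range N, sympl
    (∑ k ∈ Finset.range j, ∫ t in Ioc (k / N : ℝ) ((k + 1 : ℕ) / N), v t ∂unitVol)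
    (∫ t in Ioc (j / N : ℝ) ((j + 1 : ℕ) / N), v t ∂unitVol)) / 2

lemma continuous_polygonArea_weakRep (N : ℕ) :
    Continuous fun φ : WeakDual ℝ (Lp (CSpace n) 2 unitVol) =>
      polygonArea N (weakRep φ : Lp (CSpace n) 2 unitVol) := by
  unfold polygonArea
  simp only [sympl_eq_sum_coord]
  simp only [map_sum]
  refine Continuous.div_const (y := (2 : ℝ)) (continuous_finsetSum _ fun j _ => continuous_finsetSum _ fun i _ =>
    Continuous.sub (Continuous.mul ?_ ?_) (Continuous.mul ?_ ?_))
  all_goals first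
    | exact continuous_inner_setIntegral_weakRep _
    | exact continuous_finsetSum _ fun k _ => continuous_inner_setIntegral_weakRep _

/-- By `area_eq_sum` the difference is the sum of the areas between the pieces and their chords, and
`abs_area_le` bounds each. The bound is uniform on `L²`-bounded sets, so there the area is a uniform
limit of weakly continuous functions. -/
lemma abs_area_sub_polygonArea_le (hv : MemLp v 2 unitVol) {N : ℕ} (hN : 0 < N) :
    |area 0 1 v - polygonArea N v| ≤ (∫ t in (0 : ℝ)..1, ‖v t‖ ^ 2) / N := by
  have hN' : (0 : ℝ) < N := Nat.cast_pos.2 hN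
  -- Extension by zero gives integrability on every interval, as `area_eq_sum` demands.
  set u := (Ioc (0 : ℝ) 1).indicator v with hu
  have hint := intervalIntegrable_indicator hv
  have hsq : ∀ a b, IntervalIntegrable (fun t => ‖u t‖ ^ 2) volume a b := by
    intro a b
    have h : (fun t => ‖u t‖ ^ 2) = (Ioc (0 : ℝ) 1).indicator fun t => ‖v t‖ ^ 2 := by
      ext t
      by_cases ht : t ∈ Ioc (0 : ℝ) 1 <;> simp [hu, ht]
    rw [h]
    exact ((integrable_indicator_iff measurableSet_Ioc).2
      ((memLp_two_iff_integrable_sq_norm hv.1).1 hv)).intervalIntegrable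
  have hmono : ∀ k : ℕ, (k / N : ℝ) ≤ ((k + 1 : ℕ) : ℝ) / N := fun k => by
    gcongr
    simp
  have h1 : area 0 1 v = area 0 1 u :=
    area_congr zero_le_one (ae_of_all _ fun t ht => (indicator_of_mem ht v).symm)
  have h2 := area_eq_sum hint (fun j : ℕ => (j / N : ℝ)) N
  have h3 : (∑ j ∈ Finset.range N,
        sympl (∑ k ∈ Finset.range j, ∫ s in (k / N : ℝ)..((k + 1 : ℕ) / N), u s)
          (∫ s in (j / N : ℝ)..((j + 1 : ℕ) / N), u s)) / 2 = polygonArea N v := by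
    have hpiece : ∀ k : ℕ, ∫ s in (k / N : ℝ)..((k + 1 : ℕ) / N), u s
        = ∫ t in Ioc (k / N : ℝ) ((k + 1 : ℕ) / N), v t ∂unitVol :=
      fun k => integral_indicator_eq (hmono k) v
    simp_rw [polygonArea, hpiece]
  rw [Nat.cast_zero, zero_div, div_self hN'.ne'] at h2
  rw [h1, h2, h3, add_sub_cancel_right]
  have h4 : ∀ j : ℕ, |area (j / N : ℝ) ((j + 1 : ℕ) / N) u|
      ≤ (1 / N) * ∫ t in (j / N : ℝ)..((j + 1 : ℕ) / N), ‖u t‖ ^ 2 := fun j => by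
    refine (abs_area_le (hmono j) (hint _ _) (hsq _ _)).trans_eq ?_
    congr 1
    rw [← sub_div]
    simp
  refine (Finset.abs_sum_le_sum_abs _ _).trans ((Finset.sum_le_sum fun j _ => h4 j).trans_eq ?_)
  rw [← Finset.mul_sum, intervalIntegral.sum_integral_adjacent_intervals
    (a := fun j : ℕ => (j / N : ℝ)) fun k _ => hsq _ _, Nat.cast_zero, zero_div, div_self hN'.ne',
    one_div, inv_mul_eq_div]
  congr 1
  apply intervalIntegral.integral_congr_ae
  refine ae_of_all _ fun t ht => ?_
  rw [uIoc_of_le zero_le_one] at ht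
  rw [hu, indicator_of_mem ht]

lemma energy_smul (hK : IsSmoothBody K) {s : ℝ} (hs : 0 ≤ s) (v : ℝ → CSpace n) :
    energy K (fun t => s • v t) = s ^ 2 * energy K v := by
  simp only [energy, hK.suppFun_smul hs, mul_pow]
  exact intervalIntegral.integral_const_mul _ _

lemma memLp_suppFun (hK : IsSmoothBody K) (hv : MemLp v 2 unitVol) :
    MemLp (fun t => suppFun K (v t)) 2 unitVol := by
  obtain ⟨C, hC⟩ := hK.exists_lipschitz
  exact hC.comp_memLp IsSmoothBody.suppFun_zero hv

lemma intervalIntegrable_suppFun_sq (hK : IsSmoothBody K) (hv : MemLp v 2 unitVol) :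
    IntervalIntegrable (fun t => suppFun K (v t) ^ 2) volume 0 1 :=
  (intervalIntegrable_iff_integrableOn_Ioc_of_le zero_le_one).2 (memLp_suppFun hK hv).integrable_sq

lemma norm_sq_eq_integral (f : Lp (CSpace n) 2 unitVol) :
    ‖f‖ ^ 2 = ∫ t in (0 : ℝ)..1, ‖f t‖ ^ 2 := by
  rw [← real_inner_self_eq_norm_sq, L2.inner_def, intervalIntegral.integral_of_le zero_le_one]
  simp only [real_inner_self_eq_norm_sq]

lemma mul_integral_norm_sq_le_energy (hK : IsSmoothBody K) {r : ℝ} (hr : 0 < r)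
    (h : Metric.closedBall 0 r ⊆ K) (hv : MemLp v 2 unitVol) :
    r ^ 2 * ∫ t in (0 : ℝ)..1, ‖v t‖ ^ 2 ≤ energy K v := by
  rw [energy, ← intervalIntegral.integral_const_mul]
  refine intervalIntegral.integral_mono_on zero_le_one
    ((intervalIntegrable_sq_of_memLp hv).const_mul _) (intervalIntegrable_suppFun_sq hK hv) ?_
  intro t _
  rw [← mul_pow]
  exact pow_le_pow_left₀ (by positivity) (hK.suppFun_lower hr h _) 2

lemma energy_nonneg : 0 ≤ energy K v :=
  intervalIntegral.integral_nonneg zero_le_one fun _ _ => sq_nonneg _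

lemma energy_eq_norm_sq {C : NNReal} (hC : LipschitzWith C (suppFun K))
    (f : Lp (CSpace n) 2 unitVol) : energy K f = ‖hC.compLp IsSmoothBody.suppFun_zero f‖ ^ 2 := by
  rw [← real_inner_self_eq_norm_sq, L2.inner_def, energy,
    intervalIntegral.integral_of_le zero_le_one]
  apply integral_congr_ae
  filter_upwards [hC.coeFn_compLp IsSmoothBody.suppFun_zero f] with t ht
  rw [ht, real_inner_self_eq_norm_sq, Function.comp_apply, Real.norm_eq_abs, sq_abs]

/-- The area functional attains its maximum under the energy constraint. -/
theorem exists_max_area (hK : IsSmoothBody K) :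
    ∃ f : Lp (CSpace n) 2 unitVol, ∫ t in (0 : ℝ)..1, f t = 0 ∧ energy K f ≤ 1 ∧
      ∀ g : Lp (CSpace n) 2 unitVol, ∫ t in (0 : ℝ)..1, g t = 0 → energy K g ≤ 1 →
        area 0 1 g ≤ area 0 1 f := by
  obtain ⟨C, hC⟩ := hK.exists_lipschitz
  obtain ⟨r, R, hr, hR, hball, -⟩ := hK.exists_radii
  set P := hC.compLp IsSmoothBody.suppFun_zero (p := 2) (μ := unitVol)
  set B : Set (Lp (CSpace n) 2 unitVol) := {f | ∫ t in (0 : ℝ)..1, f t = 0} ∩ {f | ‖P f‖ ≤ 1}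
  have hmemB : ∀ f, f ∈ B ↔ ∫ t in (0 : ℝ)..1, f t = 0 ∧ energy K f ≤ 1 := fun f => by
    rw [energy_eq_norm_sq hC, sq_le_one_iff₀ (norm_nonneg _)]
    rfl
  have hnorm : ∀ f ∈ B, ‖f‖ ^ 2 ≤ 1 / r ^ 2 := fun f hf => by
    have h1 := mul_integral_norm_sq_le_energy hK hr hball (Lp.memLp f)
    rw [← norm_sq_eq_integral] at h1
    rw [le_div_iff₀ (pow_pos hr 2), mul_comm]
    exact h1.trans ((hmemB f).1 hf).2
  -- Closing up means orthogonality to all constant functions; this makes the condition closed and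
  -- convex.
  have hzero : ∀ f : Lp (CSpace n) 2 unitVol, ∫ t in (0 : ℝ)..1, f t = 0 ↔
      ∀ c : CSpace n, inner ℝ (indicatorConstLp 2 (MeasurableSet.univ) (measure_ne_top unitVol _) c)
        f = 0 := fun f => by
    simp_rw [L2.inner_indicatorConstLp_eq_inner_setIntegral,
      intervalIntegral.integral_of_le zero_le_one, Measure.restrict_univ]
    exact ⟨fun h c => by rw [h, inner_zero_right], fun h => inner_self_eq_zero.1 (h _)⟩
  have hclosed : IsClosed B := by
    refine IsClosed.inter ?_ ?_
    · simp_rw [hzero, ofPred_forall]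
      exact isClosed_iInter fun c => isClosed_eq (by fun_prop) continuous_const
    · exact isClosed_le (hC.continuous_compLp IsSmoothBody.suppFun_zero).norm continuous_const
  have hconv : Convex ℝ B := by
    refine Convex.inter ?_ ?_
    · intro f hf g hg s t _ _ _
      rw [mem_ofPred_eq, hzero] at hf hg ⊢
      intro c
      rw [inner_add_right, inner_smul_right, inner_smul_right, hf, hg, mul_zero, mul_zero, add_zero]
    · intro f hf g hg s t hs ht hst
      -- `P` is not linear, but subadditivity and positive homogeneity of `suppFun K` give the bound
      -- pointwise.
      have h1 : ‖P (s • f + t • g)‖ ≤ ‖s • P f + t • P g‖ := by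
        apply Lp.norm_le_norm_of_ae_le
        filter_upwards [hC.coeFn_compLp IsSmoothBody.suppFun_zero f, hC.coeFn_compLp IsSmoothBody.suppFun_zero g,
          hC.coeFn_compLp IsSmoothBody.suppFun_zero (s • f + t • g), Lp.coeFn_add (s • f) (t • g),
          Lp.coeFn_smul s f, Lp.coeFn_smul t g, Lp.coeFn_add (s • P f) (t • P g),
          Lp.coeFn_smul s (P f), Lp.coeFn_smul t (P g)] with x h1 h2 h3 h4 h5 h6 h7 h8 h9
        rw [h3, h7, Pi.add_apply, h8, h9, Pi.smul_apply, Pi.smul_apply, h1, h2,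
          Function.comp_apply, Function.comp_apply, Function.comp_apply, h4, Pi.add_apply, h5, h6,
          Pi.smul_apply, Pi.smul_apply, Real.norm_of_nonneg (hK.suppFun_nonneg _),
          smul_eq_mul, smul_eq_mul, ← hK.suppFun_smul hs,
          ← hK.suppFun_smul ht]
        exact (hK.suppFun_add_le _ _).trans (le_abs_self _)
      refine h1.trans ((norm_add_le _ _).trans ?_)
      rw [norm_smul, norm_smul, Real.norm_of_nonneg hs, Real.norm_of_nonneg ht, ← hst]
      exact add_le_add (mul_le_of_le_one_right hs hf) (mul_le_of_le_one_right ht hg)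
  have hbdd : Bornology.IsBounded B := by
    refine (Metric.isBounded_closedBall (x := (0 : Lp (CSpace n) 2 unitVol))
      (r := 1 / r)).subset fun f hf => ?_
    rw [mem_closedBall_zero_iff]
    refine le_of_sq_le_sq ?_ (by positivity)
    rw [div_pow, one_pow]
    exact hnorm f hf
  have hne : B.Nonempty := ⟨0, by
    rw [hmemB, hzero]
    refine ⟨fun c => inner_zero_right _, ?_⟩
    rw [energy_eq_norm_sq hC]
    simp⟩
  obtain ⟨f, hf, hmax⟩ := exists_isMaxOn_of_tendstoUniformlyOn hclosed hconv hbdd hne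
    (F := fun f => area 0 1 f) (G := fun N f => polygonArea N f) continuous_polygonArea_weakRep (by
      rw [Metric.tendstoUniformlyOn_iff]
      intro ε hε
      have hlim : Tendsto (fun N : ℕ => (1 / r ^ 2) / (N : ℝ)) atTop (𝓝 0) :=
        tendsto_const_nhds.div_atTop tendsto_natCast_atTop_atTop
      filter_upwards [hlim.eventually_lt_const hε, eventually_gt_atTop 0] with N hN hN0 f hf
      rw [Real.dist_eq]
      refine ((abs_area_sub_polygonArea_le (Lp.memLp f) hN0).trans ?_).trans_lt hN
      rw [← norm_sq_eq_integral]
      exact div_le_div_of_nonneg_right (hnorm f hf) (Nat.cast_nonneg _))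
  refine ⟨f, ((hmemB f).1 hf).1, ((hmemB f).1 hf).2, fun g h1 h2 => hmax g ((hmemB g).2 ⟨h1, h2⟩)⟩

lemma area_nonpos_of_energy_eq_zero (hK : IsSmoothBody K) (hv : MemLp v 2 unitVol)
    (h : energy K v ≤ 0) : area 0 1 v ≤ 0 := by
  obtain ⟨r, R, hr, hR, hball, -⟩ := hK.exists_radii
  have h1 := mul_integral_norm_sq_le_energy hK hr hball hv
  have h2 := abs_area_le zero_le_one (intervalIntegrable_of_memLp hv)
    (intervalIntegrable_sq_of_memLp hv)
  have h3 := pow_pos hr 2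
  have h4 : ∫ t in (0 : ℝ)..1, ‖v t‖ ^ 2 ≤ 0 := by
    by_contra hn
    push Not at hn
    have := mul_pos h3 hn
    linarith
  linarith [le_abs_self (area 0 1 v)]

lemma energy_congr {u : ℝ → CSpace n} (h : u =ᵐ[unitVol] v) : energy K u = energy K v := by
  rw [energy, energy, intervalIntegral.integral_of_le zero_le_one,
    intervalIntegral.integral_of_le zero_le_one]
  refine integral_congr_ae ?_
  filter_upwards [h] with t ht
  rw [ht]

/-- The sharp isoperimetric inequality for closed curves, together with an extremal curve. -/
theorem exists_isoperimetric (hK : IsSmoothBody K) {v₀ : ℝ → CSpace n} (hv₀ : MemLp v₀ 2 unitVol)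
    (hclosed : ∫ t in (0 : ℝ)..1, v₀ t = 0) (hpos : 0 < area 0 1 v₀) :
    ∃ a > 0, (∀ v, MemLp v 2 unitVol → ∫ t in (0 : ℝ)..1, v t = 0 → area 0 1 v ≤ a * energy K v) ∧
      ∃ v, MemLp v 2 unitVol ∧ ∫ t in (0 : ℝ)..1, v t = 0 ∧ area 0 1 v = a * energy K v ∧
        0 < energy K v := by
  obtain ⟨f, hf0, hf1, hmax⟩ := exists_max_area hK
  have key : ∀ v, MemLp v 2 unitVol → ∫ t in (0 : ℝ)..1, v t = 0 →
      area 0 1 v ≤ area 0 1 f * energy K v := by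
    intro v hv h0
    rcases (energy_nonneg (K := K) (v := v)).eq_or_lt with he | he
    · rw [← he, mul_zero]
      exact area_nonpos_of_energy_eq_zero hK hv he.ge
    -- Area and energy are both homogeneous of degree two, so the curve may be rescaled to energy
    -- `1`.
    set s := (Real.sqrt (energy K v))⁻¹ with hs
    have hs0 : 0 ≤ s := by positivity
    have hs2 : s ^ 2 * energy K v = 1 := by
      rw [hs, inv_pow, Real.sq_sqrt he.le, inv_mul_cancel₀ he.ne']
    have hsv : MemLp (fun t => s • v t) 2 unitVol := hv.const_smul s
    have hco := hsv.coeFn_toLp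
    have h1 : ∫ t in (0 : ℝ)..1, (hsv.toLp _ : Lp (CSpace n) 2 unitVol) t = 0 := by
      rw [intervalIntegral.integral_of_le zero_le_one, integral_congr_ae hco,
        ← intervalIntegral.integral_of_le zero_le_one, intervalIntegral.integral_smul, h0, smul_zero]
    have h2 : energy K (hsv.toLp _ : Lp (CSpace n) 2 unitVol) = 1 := by
      rw [energy_congr hco, energy_smul hK hs0, hs2]
    have h3 := hmax (hsv.toLp _) h1 h2.le
    have h4 : area 0 1 (hsv.toLp _ : Lp (CSpace n) 2 unitVol) = s ^ 2 * area 0 1 v := by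
      rw [← area_smul]
      exact area_congr zero_le_one ((ae_restrict_iff' measurableSet_Ioc).1 hco)
    rw [h4] at h3
    calc area 0 1 v = (s ^ 2 * area 0 1 v) * energy K v := by
          rw [mul_right_comm, hs2, one_mul]
      _ ≤ _ := mul_le_mul_of_nonneg_right h3 he.le
  have hfpos : 0 < area 0 1 f := by
    by_contra hn
    have := key v₀ hv₀ hclosed
    have := mul_nonpos_of_nonpos_of_nonneg (not_lt.1 hn) (energy_nonneg (K := K) (v := v₀))
    linarith
  -- The constraint is saturated: with energy below `1`, `key` applied to `f` would make its
  -- positive area smaller than itself.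
  have hfe : energy K f = 1 := by
    refine le_antisymm hf1 ?_
    have := key f (Lp.memLp f) hf0
    by_contra hn
    have := mul_lt_mul_of_pos_left (not_le.1 hn) hfpos
    linarith
  exact ⟨_, hfpos, key, f, Lp.memLp f, hf0, by rw [hfe, mul_one], by rw [hfe]; exact one_pos⟩

end UnitInterval

/-! ### The Euler–Lagrange equation -/

section EulerLagrange

variable {n : ℕ} {K : Set (CSpace n)} {v φ : ℝ → CSpace n}

lemma memLp_suppGrad (hK : IsSmoothBody K) (hv : MemLp v 2 unitVol) :
    MemLp (fun t => suppGrad K (v t)) 2 unitVol := by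
  obtain ⟨r, R, hr, hR, -, h⟩ := hK.exists_radii
  exact hv.of_le_mul (hK.continuous_suppGrad.comp_aestronglyMeasurable hv.1)
    (ae_of_all _ fun t => hK.norm_suppGrad_le h (v t))

lemma intervalIntegrable_sympl_of_memLp (hv : MemLp v 2 unitVol) (hφ : MemLp φ 2 unitVol) :
    IntervalIntegrable (fun t => sympl (v t) (φ t)) volume 0 1 :=
  (intervalIntegrable_iff_integrableOn_Ioc_of_le zero_le_one).2
    (memLp_one_iff_integrable.1 (sympl.memLp_of_bilin 1 hv hφ))

lemma memLp_primitive (hv : MemLp v 2 unitVol) :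
    MemLp (fun t => ∫ s in (0 : ℝ)..t, v s) 2 unitVol := by
  have hc := continuousOn_primitive_uIcc (intervalIntegrable_of_memLp hv)
  rw [uIcc_of_le zero_le_one] at hc
  obtain ⟨C, hC⟩ := isCompact_Icc.exists_bound_of_continuousOn hc
  exact MemLp.of_bound ((hc.mono Ioc_subset_Icc_self).aestronglyMeasurable measurableSet_Ioc) C
    ((ae_restrict_iff' measurableSet_Ioc).2 (ae_of_all _ fun t ht => hC t (Ioc_subset_Icc_self ht)))

/-- The subgradient inequality is based at the varied velocity, so that it bounds the new energy
from above. -/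
lemma energy_add_smul_le (hK : IsSmoothBody K) (hv : MemLp v 2 unitVol) (hφ : MemLp φ 2 unitVol)
    (ε : ℝ) : energy K (fun t => v t + ε • φ t) ≤ energy K v
      + 2 * ε * ∫ t in (0 : ℝ)..1, sympl (suppGrad K (v t + ε • φ t)) (φ t) := by
  have hu : MemLp (fun t => v t + ε • φ t) 2 unitVol := hv.add (hφ.const_smul ε)
  have hi := intervalIntegrable_sympl_of_memLp (memLp_suppGrad hK hu) hφ
  rw [energy, energy, ← intervalIntegral.integral_const_mul, ← intervalIntegral.integral_add
    (intervalIntegrable_suppFun_sq hK hv) (hi.const_mul _)]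
  refine intervalIntegral.integral_mono_on zero_le_one (intervalIntegrable_suppFun_sq hK hu)
    ((intervalIntegrable_suppFun_sq hK hv).add (hi.const_mul _)) fun t _ => ?_
  have h := hK.two_sympl_suppGrad_le (v t + ε • φ t) (v t)
  rw [sub_add_cancel_left, map_neg, map_smul, smul_eq_mul] at h
  linarith

lemma tendsto_integral_sympl_suppGrad (hK : IsSmoothBody K) (hv : MemLp v 2 unitVol)
    (hφ : MemLp φ 2 unitVol) :
    Tendsto (fun ε : ℝ => ∫ t in (0 : ℝ)..1, sympl (suppGrad K (v t + ε • φ t)) (φ t)) (𝓝[>] 0)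
      (𝓝 (∫ t in (0 : ℝ)..1, sympl (suppGrad K (v t)) (φ t))) := by
  obtain ⟨r, R, hr, hR, -, hbd⟩ := hK.exists_radii
  have hu : ∀ ε : ℝ, MemLp (fun t => v t + ε • φ t) 2 unitVol := fun ε => hv.add (hφ.const_smul ε)
  refine intervalIntegral.tendsto_integral_filter_of_dominated_convergence
    (fun t => R ^ 2 * ((‖v t‖ + ‖φ t‖) * ‖φ t‖)) ?_ ?_ ?_ ?_
  · refine Eventually.of_forall fun ε => ?_
    rw [uIoc_of_le zero_le_one]
    exact (intervalIntegrable_sympl_of_memLp (memLp_suppGrad hK (hu ε)) hφ).1.aestronglyMeasurable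
  · have h1 : ∀ᶠ ε : ℝ in 𝓝[>] 0, ε < 1 :=
      eventually_nhdsWithin_of_eventually_nhds (eventually_lt_nhds one_pos)
    filter_upwards [h1, self_mem_nhdsWithin] with ε hε1 hε0
    refine ae_of_all _ fun t _ => ?_
    rw [Real.norm_eq_abs, ← mul_assoc]
    refine (abs_sympl_le _ _).trans (mul_le_mul_of_nonneg_right ?_ (norm_nonneg _))
    refine (hK.norm_suppGrad_le hbd _).trans (mul_le_mul_of_nonneg_left ?_ (sq_nonneg R))
    refine (norm_add_le _ _).trans (add_le_add le_rfl ?_)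
    rw [norm_smul, Real.norm_of_nonneg (le_of_lt hε0)]
    exact mul_le_of_le_one_left (norm_nonneg _) hε1.le
  · have h1 : IntegrableOn (fun t => (‖v t‖ + ‖φ t‖) * ‖φ t‖) (Ioc 0 1) volume :=
      (hv.norm.add hφ.norm).integrable_mul hφ.norm
    exact ((intervalIntegrable_iff_integrableOn_Ioc_of_le zero_le_one).2 h1).const_mul _
  · refine ae_of_all _ fun t _ => ?_
    have hc : Continuous fun ε : ℝ => sympl (suppGrad K (v t + ε • φ t)) (φ t) := by
      have h1 : Continuous fun ε : ℝ => suppGrad K (v t + ε • φ t) :=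
        hK.continuous_suppGrad.comp (by fun_prop)
      exact (sympl.flip (φ t)).continuous.comp h1
    have := hc.tendsto 0
    simp only [zero_smul, add_zero] at this
    exact this.mono_left nhdsWithin_le_nhds

/-- `v` is the velocity of a closed curve. -/
structure IsClosedVelocity (v : ℝ → CSpace n) : Prop where
  memLp : MemLp v 2 unitVol
  integral_eq_zero : ∫ t in (0 : ℝ)..1, v t = 0

/-- The isoperimetric inequality with constant `a` for closed curves. -/
def Isoperimetric (K : Set (CSpace n)) (a : ℝ) : Prop :=
  ∀ v : ℝ → CSpace n, IsClosedVelocity v → area 0 1 v ≤ a * energy K v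

/-- The isoperimetric inequality for `v + ε φ` is compared with equality at `v`, divided by `ε > 0`,
and passed to the limit by continuity of `suppGrad K`. Since `φ` may be replaced by its negative,
the one-sided inequality suffices. -/
lemma crossInt_le_of_extremal (hK : IsSmoothBody K) {a : ℝ} (ha : 0 ≤ a) (hiso : Isoperimetric K a)
    (hv : IsClosedVelocity v) (heq : area 0 1 v = a * energy K v) (hφ : IsClosedVelocity φ) :
    crossInt 0 1 v φ ≤ 2 * a * ∫ t in (0 : ℝ)..1, sympl (suppGrad K (v t)) (φ t) := by
  have hvi := intervalIntegrable_of_memLp hv.memLp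
  have hφi := intervalIntegrable_of_memLp hφ.memLp
  have key : ∀ ε : ℝ, 0 < ε → crossInt 0 1 v φ + ε * area 0 1 φ
      ≤ 2 * a * ∫ t in (0 : ℝ)..1, sympl (suppGrad K (v t + ε • φ t)) (φ t) := by
    intro ε hε
    have h1 := hiso (fun t => v t + ε • φ t) ⟨hv.memLp.add (hφ.memLp.const_smul ε), by
      have hεφ : IntervalIntegrable (fun t => ε • φ t) volume 0 1 := hφi.smul ε
      rw [intervalIntegral.integral_add hvi hεφ, intervalIntegral.integral_smul,
        hv.integral_eq_zero, hφ.integral_eq_zero, smul_zero, add_zero]⟩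
    rw [area_add_smul hvi hφi hφ.integral_eq_zero, heq] at h1
    have h2 := mul_le_mul_of_nonneg_left (energy_add_smul_le hK hv.memLp hφ.memLp ε) ha
    set I := ∫ t in (0 : ℝ)..1, sympl (suppGrad K (v t + ε • φ t)) (φ t)
    have h3 : ε * (crossInt 0 1 v φ + ε * area 0 1 φ) ≤ ε * (2 * a * I) := by linarith
    exact le_of_mul_le_mul_left h3 hε
  have hl : Tendsto (fun ε : ℝ => crossInt 0 1 v φ + ε * area 0 1 φ) (𝓝[>] 0)
      (𝓝 (crossInt 0 1 v φ)) := by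
    have hc : Continuous fun ε : ℝ => crossInt 0 1 v φ + ε * area 0 1 φ := by fun_prop
    have := hc.tendsto 0
    simp only [zero_mul, add_zero] at this
    exact this.mono_left nhdsWithin_le_nhds
  refine le_of_tendsto_of_tendsto hl
    ((tendsto_integral_sympl_suppGrad hK hv.memLp hφ.memLp).const_mul (2 * a)) ?_
  filter_upwards [self_mem_nhdsWithin] with ε hε using key ε hε

lemma crossInt_eq_of_extremal (hK : IsSmoothBody K) {a : ℝ} (ha : 0 ≤ a) (hiso : Isoperimetric K a)
    (hv : IsClosedVelocity v) (heq : area 0 1 v = a * energy K v) (hφ : IsClosedVelocity φ) :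
    crossInt 0 1 v φ = 2 * a * ∫ t in (0 : ℝ)..1, sympl (suppGrad K (v t)) (φ t) := by
  refine le_antisymm (crossInt_le_of_extremal hK ha hiso hv heq hφ) ?_
  have h := crossInt_le_of_extremal hK ha hiso hv heq (φ := fun t => (-1 : ℝ) • φ t)
    ⟨hφ.memLp.const_smul (-1 : ℝ), by
      rw [intervalIntegral.integral_smul, hφ.integral_eq_zero, smul_zero]⟩
  simp only [crossInt_smul_right, map_smul, smul_eq_mul, intervalIntegral.integral_const_mul] at h
  linarith

/-- The Euler--Lagrange equation of extremal curves for the isoperimetric inequality. -/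
theorem euler_lagrange (hK : IsSmoothBody K) {a : ℝ} (ha : 0 ≤ a) (hiso : Isoperimetric K a)
    (hv : IsClosedVelocity v) (heq : area 0 1 v = a * energy K v) :
    ∃ c : CSpace n, ∀ᵐ t ∂unitVol,
      (∫ s in (0 : ℝ)..t, v s) - c = (2 * a) • suppGrad K (v t) := by
  set ψ : ℝ → CSpace n := fun t => (∫ s in (0 : ℝ)..t, v s) - (2 * a) • suppGrad K (v t) with hψ
  have hP := memLp_primitive hv.memLp
  have hX := memLp_suppGrad hK hv.memLp
  have hψm : MemLp ψ 2 unitVol := hP.sub (hX.const_smul (2 * a))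
  set c := ∫ t in (0 : ℝ)..1, ψ t with hc
  have hcm : MemLp (fun _ : ℝ => c) 2 unitVol := memLp_const c
  have hχ : MemLp (fun t => ψ t - c) 2 unitVol := hψm.sub hcm
  have hψi := intervalIntegrable_of_memLp hψm
  -- The test variation is `i` times the deviation of `ψ` from its mean `c`. It has mean zero, and
  -- pairing with `i` turns `sympl` into the inner product, so the first variation becomes the
  -- squared `L²` norm of the deviation.
  have hφ : IsClosedVelocity (fun t => Complex.I • (ψ t - c)) := by
    refine ⟨hχ.const_smul Complex.I, ?_⟩
    rw [intervalIntegral.integral_smul, intervalIntegral.integral_sub hψi intervalIntegrable_const,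
      intervalIntegral.integral_const, ← hc]
    simp
  have h1 := crossInt_eq_of_extremal hK ha hiso hv heq hφ
  have h2 : ∫ t in (0 : ℝ)..1, sympl (ψ t) (Complex.I • (ψ t - c)) = 0 := by
    have h3 : ∀ t, sympl (ψ t) (Complex.I • (ψ t - c))
        = sympl (∫ s in (0 : ℝ)..t, v s) (Complex.I • (ψ t - c))
          - 2 * a * sympl (suppGrad K (v t)) (Complex.I • (ψ t - c)) := fun t => by
      simp only [hψ, map_sub, map_smul, sub_apply, smul_apply, smul_eq_mul]
    simp_rw [h3]
    rw [intervalIntegral.integral_sub (intervalIntegrable_sympl_of_memLp hP hφ.memLp)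
      ((intervalIntegrable_sympl_of_memLp hX hφ.memLp).const_mul _),
      intervalIntegral.integral_const_mul, ← h1, crossInt, sub_self]
  have h4 : ∫ t in (0 : ℝ)..1, sympl c (Complex.I • (ψ t - c)) = 0 := by
    rw [(sympl c).intervalIntegral_comp_comm (intervalIntegrable_of_memLp hφ.memLp),
      hφ.integral_eq_zero, map_zero]
  have h5 : ∫ t in (0 : ℝ)..1, ‖ψ t - c‖ ^ 2 = 0 := by
    have : ∀ t, ‖ψ t - c‖ ^ 2
        = sympl (ψ t) (Complex.I • (ψ t - c)) - sympl c (Complex.I • (ψ t - c)) := fun t => by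
      rw [← sympl_I_self, map_sub, sub_apply, map_sub]
    simp_rw [this]
    rw [intervalIntegral.integral_sub (intervalIntegrable_sympl_of_memLp hψm hφ.memLp)
      (intervalIntegrable_sympl_of_memLp hcm hφ.memLp), h2, h4, sub_zero]
  rw [intervalIntegral.integral_of_le zero_le_one, integral_eq_zero_iff_of_nonneg
    (fun t => sq_nonneg _) ((memLp_two_iff_integrable_sq_norm hχ.1).1 hχ)] at h5
  refine ⟨c, ?_⟩
  filter_upwards [h5] with t ht
  have : ψ t - c = 0 := by simpa using ht
  rw [sub_eq_zero] at this
  rw [← this, hψ]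
  exact sub_sub_cancel _ _

end EulerLagrange

/-! ### From extremals to closed characteristics -/

/-- A closed `C¹` curve on the boundary of `K` whose velocity `d` is a positive multiple of the
characteristic direction. -/
structure IsPosLoop {n : ℕ} (K : Set (CSpace n)) (T : ℝ) (η d : ℝ → CSpace n) : Prop where
  pos : 0 < T
  continuous : Continuous d
  hasDeriv : ∀ t ∈ Icc 0 T, HasDerivWithinAt η (d t) (Icc 0 T) t
  closed : η 0 = η T
  mem : ∀ t ∈ Icc 0 T, η t ∈ K
  support : ∀ t ∈ Icc 0 T, sympl (η t) (d t) = suppFun K (d t)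
  ne_zero : ∀ t ∈ Icc 0 T, d t ≠ 0

section Regularity

variable {n : ℕ} {K : Set (CSpace n)}

/-- The energy of a solution of the characteristic equation is conserved. -/
lemma suppFun_const_of_suppGrad_eq (hK : IsSmoothBody K) {a : ℝ} {Y d : ℝ → CSpace n}
    (hd : Continuous d) (hY : ∀ t, HasDerivAt Y (d t) t)
    (hX : ∀ t ∈ Icc (0 : ℝ) 1, Y t = a • suppGrad K (d t)) (ha : 0 < a) :
    ∀ t ∈ Icc (0 : ℝ) 1, suppFun K (d t) = suppFun K (d 0) := by
  set f : ℝ → ℝ := fun t => suppFun K (d t) ^ 2 with hf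
  -- As `d` is only continuous, `f` cannot be differentiated by the chain rule. Convexity bounds `f
  -- s - f t` from below, and with `s` and `t` exchanged from above; both bounds are `o(s - t)`.
  have hle : ∀ t ∈ Icc (0 : ℝ) 1, ∀ s ∈ Icc (0 : ℝ) 1,
      2 * (a⁻¹ * sympl (Y s - Y t) (d t)) ≤ f s - f t := by
    intro t ht s hs
    have h1 : sympl (suppGrad K (d s)) (d t) ≤ suppFun K (d s) * suppFun K (d t) := by
      rw [suppGrad, map_smul, smul_apply, smul_eq_mul]
      exact mul_le_mul_of_nonneg_left (hK.sympl_supportPt_le _ _) (hK.suppFun_nonneg _)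
    have h2 : sympl (suppGrad K (d t)) (d t) = suppFun K (d t) ^ 2 := by
      rw [suppGrad, map_smul, smul_apply, smul_eq_mul, ← suppFun, sq]
    have h3 : a⁻¹ * sympl (Y s - Y t) (d t)
        = sympl (suppGrad K (d s)) (d t) - sympl (suppGrad K (d t)) (d t) := by
      rw [hX s hs, hX t ht, map_sub, sub_apply, map_smul, map_smul, smul_apply, smul_apply,
        smul_eq_mul, smul_eq_mul, ← mul_sub, inv_mul_cancel_left₀ ha.ne']
    rw [h3, h2]
    simp only [hf]
    nlinarith [sq_nonneg (suppFun K (d s) - suppFun K (d t))]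
  have hderiv : ∀ t ∈ Icc (0 : ℝ) 1, HasDerivWithinAt f 0 (Icc 0 1) t := by
    intro t ht
    have hYt := (hY t).isLittleO
    -- To first order `Y s - Y t` is `(s - t) d t`, which pairs to zero with `d t`.
    have hP : (fun s => sympl (Y s - Y t) (d t)) =o[𝓝 t] fun s => s - t := by
      have h1 : (fun s => sympl (Y s - Y t) (d t))
          = fun s => (sympl.flip (d t)) (Y s - Y t - (s - t) • d t) := by
        ext s
        rw [ContinuousLinearMap.flip_apply, map_sub sympl (Y s - Y t), sub_apply, map_smul,
          smul_apply, sympl_self, smul_zero, sub_zero]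
      rw [h1]
      exact ((sympl.flip (d t)).isBigO_comp _ _).trans_isLittleO hYt
    -- Replacing `d s` by `d t` costs `O(s - t)` times a quantity that tends to zero by continuity
    -- of `d`.
    have hQ : (fun s => sympl (Y t - Y s) (d s)) =o[𝓝 t] fun s => s - t := by
      have h1 : (fun s => sympl (Y t - Y s) (d s))
          = fun s => sympl (Y t - Y s) (d s - d t) - sympl (Y s - Y t) (d t) := by
        ext s
        simp only [map_sub, sub_apply]
        ring
      rw [h1]
      refine Asymptotics.IsLittleO.sub ?_ hP
      have h2 : (fun s => sympl (Y t - Y s) (d s - d t))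
          =O[𝓝 t] fun s => ‖Y s - Y t‖ * ‖d s - d t‖ := by
        refine Asymptotics.IsBigO.of_bound 1 (Eventually.of_forall fun s => ?_)
        rw [one_mul, Real.norm_eq_abs, norm_mul, norm_norm, norm_norm, norm_sub_rev (Y s)]
        exact abs_sympl_le _ _
      refine h2.trans_isLittleO ?_
      have h3 : (fun s => ‖d s - d t‖) =o[𝓝 t] fun _ => (1 : ℝ) := by
        rw [Asymptotics.isLittleO_one_iff]
        have : Continuous fun s => ‖d s - d t‖ := (hd.sub continuous_const).norm
        simpa using this.tendsto t
      simpa using (hY t).isBigO_sub.norm_left.mul_isLittleO h3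
    rw [hasDerivWithinAt_iff_isLittleO]
    simp only [smul_zero, sub_zero]
    have hPQ := ((hP.norm_left.add hQ.norm_left).const_mul_left (2 * a⁻¹)).mono
      (nhdsWithin_le_nhds (s := Icc 0 1))
    refine Asymptotics.IsBigO.trans_isLittleO ?_ hPQ
    refine Asymptotics.IsBigO.of_bound 1 ?_
    filter_upwards [self_mem_nhdsWithin] with s hs
    have e1 := hle t ht s hs
    have e2 := hle s hs t ht
    have hA : 0 < 2 * a⁻¹ := by positivity
    rw [one_mul, Real.norm_eq_abs, Real.norm_eq_abs]
    refine le_trans ?_ (le_abs_self _)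
    have p1 := mul_le_mul_of_nonneg_left (neg_abs_le (sympl (Y s - Y t) (d t))) hA.le
    have p2 := mul_le_mul_of_nonneg_left (neg_abs_le (sympl (Y t - Y s) (d s))) hA.le
    have q1 := mul_nonneg hA.le (abs_nonneg (sympl (Y s - Y t) (d t)))
    have q2 := mul_nonneg hA.le (abs_nonneg (sympl (Y t - Y s) (d s)))
    rw [Real.norm_eq_abs, Real.norm_eq_abs, abs_le]
    constructor <;> linarith
  intro t ht
  have hconst := constant_of_derivWithin_zero (f := f) (a := 0) (b := 1)
    (fun t ht => (hderiv t ht).differentiableWithinAt)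
    (fun t ht => (hderiv t (Ico_subset_Icc_self ht)).derivWithin
      ((uniqueDiffOn_Icc zero_lt_one) t (Ico_subset_Icc_self ht))) t ht
  exact (pow_left_inj₀ (hK.suppFun_nonneg _) (hK.suppFun_nonneg _) two_ne_zero).1 hconst

/-- Extremal curves of the isoperimetric inequality are characteristics up to translation and
scaling. -/
theorem exists_posLoop_of_extremal (hK : IsSmoothBody K) {a : ℝ} (ha : 0 < a)
    (hiso : Isoperimetric K a) {v : ℝ → CSpace n} (hv : IsClosedVelocity v)
    (heq : area 0 1 v = a * energy K v) (hpos : 0 < energy K v) :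
    ∃ η d : ℝ → CSpace n, IsPosLoop K 1 η d ∧ ∫ t in (0 : ℝ)..1, suppFun K (d t) = 1 / (2 * a) := by
  obtain ⟨c, hc⟩ := euler_lagrange hK ha.le hiso hv heq
  have h2a : 0 < 2 * a := by positivity
  set y : ℝ → CSpace n := fun t => (2 * a)⁻¹ • ((∫ s in (0 : ℝ)..t, v s) - c) with hy
  have hyc : ContinuousOn y (Icc 0 1) := by
    have h := continuousOn_primitive_uIcc (intervalIntegrable_of_memLp hv.memLp)
    rw [uIcc_of_le zero_le_one] at h
    exact (h.sub continuousOn_const).const_smul (2 * a)⁻¹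
  have hyX : ∀ᵐ t ∂unitVol, y t = suppGrad K (v t) := by
    filter_upwards [hc] with t ht
    rw [hy]
    simp only
    rw [ht, inv_smul_smul₀ h2a.ne']
  have hemb := hK.isClosedEmbedding_suppGrad
  have hrange : ∀ t ∈ Icc (0 : ℝ) 1, y t ∈ range (suppGrad K) := by
    -- The equation holds almost everywhere only. The continuous distance of `y` to the closed range
    -- vanishes almost everywhere, hence everywhere.
    have h1 : EqOn (fun t => Metric.infDist (y t) (range (suppGrad K))) (fun _ => 0) (Icc 0 1) := by
      refine Measure.eqOn_Icc_of_ae_eq volume zero_ne_one ?_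
        ((Metric.continuous_infDist_pt _).comp_continuousOn hyc) continuousOn_const
      rw [restrict_Ioc_eq_restrict_Icc.symm]
      filter_upwards [hyX] with t ht
      rw [ht]
      exact Metric.infDist_zero_of_mem (mem_range_self _)
    intro t ht
    exact (hemb.isClosed_range.mem_iff_infDist_zero (range_nonempty _)).2 (h1 ht)
  choose! d₀ hd₀ using hrange
  have hd₀c : ContinuousOn d₀ (Icc 0 1) := by
    rw [hemb.isInducing.continuousOn_iff]
    exact hyc.congr hd₀
  set d : ℝ → CSpace n := IccExtend zero_le_one ((Icc (0 : ℝ) 1).domRestrict d₀) with hd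
  have hdc : Continuous d := (continuousOn_iff_continuous_domRestrict.1 hd₀c).Icc_extend'
  have hdd : ∀ t ∈ Icc (0 : ℝ) 1, d t = d₀ t := fun t ht => IccExtend_of_mem _ _ ht
  have hdX : ∀ t ∈ Icc (0 : ℝ) 1, suppGrad K (d t) = y t := fun t ht => by rw [hdd t ht, hd₀ t ht]
  have hdv : ∀ᵐ t ∂unitVol, d t = v t := by
    filter_upwards [hyX, ae_restrict_mem measurableSet_Ioc] with t ht hmem
    exact hK.injective_suppGrad ((hdX t (Ioc_subset_Icc_self hmem)).trans ht)
  have hdv' : ∀ᵐ t, t ∈ Ioc (0 : ℝ) 1 → d t = v t := (ae_restrict_iff' measurableSet_Ioc).1 hdv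
  set Y : ℝ → CSpace n := fun t => (∫ s in (0 : ℝ)..t, d s) - c with hYdef
  have hYy : ∀ t ∈ Icc (0 : ℝ) 1, Y t = (2 * a) • suppGrad K (d t) := by
    intro t ht
    rw [hdX t ht, hy]
    simp only
    rw [smul_inv_smul₀ h2a.ne', hYdef]
    simp only
    congr 1
    apply intervalIntegral.integral_congr_ae
    filter_upwards [hdv'] with s hs hmem
    rw [uIoc_of_le ht.1] at hmem
    exact hs ⟨hmem.1, hmem.2.trans ht.2⟩
  have hYd : ∀ t, HasDerivAt Y (d t) t := fun t =>
    (hdc.integral_hasStrictDerivAt 0 t).hasDerivAt.sub_const c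
  have hconst := suppFun_const_of_suppGrad_eq hK hdc hYd hYy h2a
  set σ := suppFun K (d 0) with hσ
  have hen : energy K v = σ ^ 2 := by
    rw [← energy_congr hdv, energy, intervalIntegral.integral_congr (g := fun _ => σ ^ 2)]
    · simp
    · intro t ht
      rw [uIcc_of_le zero_le_one] at ht
      simp only
      rw [hconst t ht]
  have hσ0 : 0 < σ := by
    refine lt_of_le_of_ne (hK.suppFun_nonneg _) fun h => ?_
    rw [hen, ← h] at hpos
    norm_num at hpos
  have hk : 0 < 2 * a * σ := by positivity
  have hne : ∀ t ∈ Icc (0 : ℝ) 1, d t ≠ 0 := fun t ht h => by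
    have := hconst t ht
    rw [h, IsSmoothBody.suppFun_zero] at this
    exact hσ0.ne this
  -- Since `suppGrad` is `σ` times the support point, division of `Y` by `2 a σ` puts the curve on
  -- the boundary and gives it the constant speed `1 / (2 a)`.
  have hpt : ∀ t ∈ Icc (0 : ℝ) 1, (2 * a * σ)⁻¹ • Y t = supportPt K (d t) := by
    intro t ht
    rw [hYy t ht, suppGrad, hconst t ht, smul_smul (2 * a), inv_smul_smul₀ hk.ne']
  refine ⟨fun t => (2 * a * σ)⁻¹ • Y t, fun t => (2 * a * σ)⁻¹ • d t, ⟨one_pos, by fun_prop, ?_, ?_,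
    ?_, ?_, ?_⟩, ?_⟩
  · exact fun t _ => ((hYd t).const_smul (2 * a * σ)⁻¹).hasDerivWithinAt
  · have h1 : ∫ s in (0 : ℝ)..1, d s = 0 := by
      rw [intervalIntegral.integral_of_le zero_le_one, integral_congr_ae hdv,
        ← intervalIntegral.integral_of_le zero_le_one, hv.integral_eq_zero]
    simp only [hYdef, h1, intervalIntegral.integral_same]
  · intro t ht
    rw [hpt t ht]
    exact hK.supportPt_mem _
  · intro t ht
    rw [hpt t ht, map_smul, hK.suppFun_smul (by positivity), smul_eq_mul, suppFun]
  · exact fun t ht => smul_ne_zero (by positivity) (hne t ht)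
  · rw [intervalIntegral.integral_congr (g := fun _ => 1 / (2 * a))]
    · simp
    · intro t ht
      rw [uIcc_of_le zero_le_one] at ht
      simp only
      rw [hK.suppFun_smul (by positivity), hconst t ht]
      field_simp

end Regularity

/-! ### Supporting directions, tangent spaces and action -/

section Geometry

variable {n : ℕ} {K : Set (CSpace n)}

/-- A nonzero functional that is nonpositive on the half-space `L < 0` is a positive multiple of `L`. -/
lemma exists_pos_smul_of_nonpos {E : Type*} [AddCommGroup E] [Module ℝ E] {p L : E →ₗ[ℝ] ℝ}
    (hp : p ≠ 0) (hL : L ≠ 0) (h : ∀ u, L u < 0 → p u ≤ 0) : ∃ c : ℝ, 0 < c ∧ p = c • L := by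
  obtain ⟨w, hw⟩ : ∃ w, L w = -1 := by
    obtain ⟨z, hz⟩ := DFunLike.ne_iff.1 hL
    refine ⟨(-(L z)⁻¹) • z, ?_⟩
    rw [map_smul, smul_eq_mul, neg_mul, inv_mul_cancel₀ hz]
  have h0 : ∀ u, L u = 0 → p u ≤ 0 := by
    intro u hu
    have hlim : Tendsto (fun ε : ℝ => p u + ε * p w) (𝓝[>] 0) (𝓝 (p u)) := by
      have hc : Continuous fun ε : ℝ => p u + ε * p w := by fun_prop
      have := hc.tendsto 0
      simp only [zero_mul, add_zero] at this
      exact this.mono_left nhdsWithin_le_nhds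
    refine le_of_tendsto hlim ?_
    filter_upwards [self_mem_nhdsWithin] with ε hε
    have := h (u + ε • w) (by
      rw [map_add, map_smul, hu, hw, smul_eq_mul]
      linarith [mem_Ioi.1 hε])
    rwa [map_add, map_smul, smul_eq_mul] at this
  have h1 : ∀ u, L u = 0 → p u = 0 := fun u hu => by
    refine le_antisymm (h0 u hu) ?_
    have := h0 (-u) (by rw [map_neg, hu, neg_zero])
    rw [map_neg] at this
    linarith
  have h2 : p = (-p w) • L := by
    ext v
    have := h1 (v + (L v) • w) (by rw [map_add, map_smul, hw, smul_eq_mul]; ring)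
    rw [map_add, map_smul, smul_eq_mul] at this
    rw [LinearMap.smul_apply, smul_eq_mul]
    linarith
  refine ⟨-p w, lt_of_le_of_ne ?_ ?_, h2⟩
  · linarith [h w (by rw [hw]; norm_num)]
  · intro hc
    rw [← hc, zero_smul] at h2
    exact hp h2

/-- Directions in which `f` decreases lead into `K`, so the supporting functional is nonpositive on
a half-space of the differential; two such functionals are positively proportional. -/
lemma exists_smul_fderiv_of_support (hK : IsClosed K) {x : CSpace n} (hx : x ∈ frontier K)
    {f : CSpace n → ℝ} (hf : IsDefiningFunctionAt K x f) {v : CSpace n} (hv : v ≠ 0)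
    (h : ∀ y ∈ K, sympl y v ≤ sympl x v) :
    ∃ c : ℝ, 0 < c ∧ ∀ u, sympl u v = c * fderiv ℝ f x u := by
  obtain ⟨U, hU, hxU, hfU, hL, hKU⟩ := hf
  have hxK : x ∈ K := hK.frontier_subset hx
  have hdiff : DifferentiableAt ℝ f x :=
    (hfU.contDiffAt (hU.mem_nhds hxU)).differentiableAt (by simp)
  have key : ∀ u, fderiv ℝ f x u < 0 → sympl u v ≤ 0 := by
    intro u hu
    have hline : HasDerivAt (fun s : ℝ => f (x + s • u)) (fderiv ℝ f x u) 0 := by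
      have h1 : HasDerivAt (fun s : ℝ => x + s • u) u 0 := by
        simpa using ((hasDerivAt_id (0 : ℝ)).smul_const u).const_add x
      have h2 : HasFDerivAt f (fderiv ℝ f x) (x + (0 : ℝ) • u) := by
        simpa using hdiff.hasFDerivAt
      exact h2.comp_hasDerivAt 0 h1
    have hslope : ∀ᶠ s : ℝ in 𝓝[>] 0, slope (fun s : ℝ => f (x + s • u)) 0 s < 0 :=
      ((hasDerivAt_iff_tendsto_slope.1 hline).mono_left
        (nhdsWithin_mono _ fun s (hs : (0 : ℝ) < s) => hs.ne')).eventually_lt_const hu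
    have hmem : ∀ᶠ s : ℝ in 𝓝[>] 0, x + s • u ∈ U := by
      have hc : Continuous fun s : ℝ => x + s • u := by fun_prop
      have h1 : Tendsto (fun s : ℝ => x + s • u) (𝓝 0) (𝓝 x) := by simpa using hc.tendsto 0
      exact (h1.mono_left nhdsWithin_le_nhds).eventually (hU.mem_nhds hxU)
    obtain ⟨s, hs1, hs2, hs3⟩ := (hslope.and (hmem.and self_mem_nhdsWithin)).exists
    have hs : (0 : ℝ) < s := hs3
    rw [slope_def_field, sub_zero, div_neg_iff] at hs1
    have hlt : f (x + s • u) - f (x + (0 : ℝ) • u) < 0 := by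
      rcases hs1 with h1 | h1
      · linarith [h1.2]
      · exact h1.1
    rw [zero_smul, add_zero] at hlt
    have hfx := (hKU x hxU).1 hxK
    have := h _ ((hKU _ hs2).2 (by linarith))
    rw [map_add, map_smul, add_apply, smul_apply, smul_eq_mul] at this
    by_contra hn
    have := mul_pos hs (not_le.1 hn)
    linarith
  have hp : ((sympl.flip v : CSpace n →L[ℝ] ℝ) : CSpace n →ₗ[ℝ] ℝ) ≠ 0 := fun h0 =>
    hv (eq_zero_of_sympl_left fun u => DFunLike.congr_fun h0 u)
  have hL' : ((fderiv ℝ f x : CSpace n →L[ℝ] ℝ) : CSpace n →ₗ[ℝ] ℝ) ≠ 0 := fun h0 =>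
    hL (ContinuousLinearMap.ext fun u => DFunLike.congr_fun h0 u)
  obtain ⟨c, hc, hcL⟩ := exists_pos_smul_of_nonpos hp hL' key
  exact ⟨c, hc, fun u => DFunLike.congr_fun hcL u⟩

lemma mem_frontier_of_support {x v : CSpace n} (hx : x ∈ K) (hv : v ≠ 0)
    (h : ∀ y ∈ K, sympl y v ≤ sympl x v) : x ∈ frontier K := by
  refine ⟨subset_closure hx, fun hi => ?_⟩
  have hc : Tendsto (fun s : ℝ => x + s • (-(Complex.I • v))) (𝓝 0) (𝓝 x) := by
    have : Continuous fun s : ℝ => x + s • (-(Complex.I • v)) := by fun_prop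
    simpa using this.tendsto 0
  have h1 : ∀ᶠ s : ℝ in 𝓝[>] 0, x + s • (-(Complex.I • v)) ∈ K :=
    (hc.mono_left nhdsWithin_le_nhds).eventually (mem_interior_iff_mem_nhds.1 hi)
  obtain ⟨s, hs1, hs2⟩ := (h1.and self_mem_nhdsWithin).exists
  have := h _ hs1
  rw [map_add, map_smul, map_neg, add_apply, smul_apply, neg_apply, sympl_I_left, neg_neg,
    real_inner_self_eq_norm_sq, smul_eq_mul] at this
  have : 0 < s * ‖v‖ ^ 2 := mul_pos hs2 (pow_pos (norm_pos_iff.2 hv) 2)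
  linarith

lemma exists_support_of_mem_frontier (hconv : Convex ℝ K) (hint : (interior K).Nonempty)
    {x : CSpace n} (hx : x ∈ frontier K) :
    ∃ v : CSpace n, v ≠ 0 ∧ ∀ y ∈ K, sympl y v ≤ sympl x v := by
  obtain ⟨p, hp⟩ := geometric_hahn_banach_open_point hconv.interior isOpen_interior hx.2
  have hpv : ∀ y, sympl y (Complex.I • (InnerProductSpace.toDual ℝ (CSpace n)).symm p) = p y := by
    intro y
    rw [sympl_I_right, real_inner_comm, InnerProductSpace.toDual_symm_apply]
  refine ⟨Complex.I • (InnerProductSpace.toDual ℝ (CSpace n)).symm p, fun h0 => ?_, fun y hy => ?_⟩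
  · obtain ⟨z, hz⟩ := hint
    have h1 := hp z hz
    rw [← hpv z, ← hpv x, h0, map_zero, map_zero] at h1
    exact lt_irrefl _ h1
  · rw [hpv, hpv]
    have hcl : y ∈ closure (interior K) := by
      rw [hconv.closure_interior_eq_closure_of_nonempty_interior hint]
      exact subset_closure hy
    exact closure_minimal (fun z hz => (hp z hz).le)
      (isClosed_le p.continuous continuous_const) hcl

lemma isSmoothBody_of_hasSmoothBoundary (hcompact : IsCompact K) (hconvex : StrictConvex ℝ K)
    (hsmooth : HasSmoothBoundary K) (h0 : (0 : CSpace n) ∈ interior K) : IsSmoothBody K := by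
  refine ⟨hcompact, hconvex, h0, fun x hx u v hu hv hxu hxv => ?_⟩
  have hfr := mem_frontier_of_support hx hu hxu
  obtain ⟨f, hf⟩ := hsmooth x hfr
  obtain ⟨c, hc, hcu⟩ := exists_smul_fderiv_of_support hcompact.isClosed hfr hf hu hxu
  obtain ⟨c', hc', hcv⟩ := exists_smul_fderiv_of_support hcompact.isClosed hfr hf hv hxv
  refine ⟨c / c', div_pos hc hc', sub_eq_zero.1 (eq_zero_of_sympl_left fun y => ?_)⟩
  rw [map_sub, map_smul, hcu, hcv, smul_eq_mul]
  field_simp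
  ring

/-- The tangent space is the `ω`-orthogonal of the supporting direction, so that direction spans the
characteristic line. -/
lemma mem_boundaryTangent_iff (hclosed : IsClosed K) (hsmooth : HasSmoothBoundary K)
    {x v : CSpace n} (hx : x ∈ frontier K) (hv : v ≠ 0) (h : ∀ y ∈ K, sympl y v ≤ sympl x v)
    (u : CSpace n) : u ∈ boundaryTangent K x ↔ sympl u v = 0 := by
  constructor
  · rintro ⟨f, hf, hu⟩
    obtain ⟨c, -, hc⟩ := exists_smul_fderiv_of_support hclosed hx hf hv h
    rw [hc, hu, mul_zero]
  · intro hu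
    obtain ⟨f, hf⟩ := hsmooth x hx
    obtain ⟨c, hc0, hc⟩ := exists_smul_fderiv_of_support hclosed hx hf hv h
    rw [hc] at hu
    exact ⟨f, hf, (mul_eq_zero.1 hu).resolve_left hc0.ne'⟩

/-- A characteristic vector is, up to sign, the supporting direction. -/
lemma support_of_mem_characteristicKernel (hK : IsSmoothBody K) (hsmooth : HasSmoothBoundary K)
    {x d : CSpace n} (hx : x ∈ frontier K) (hd : d ∈ characteristicKernel K x) :
    sympl x d = suppFun K d ∨ sympl x (-d) = suppFun K (-d) := by
  have hcl := hK.compact.isClosed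
  have hxK := hcl.frontier_subset hx
  obtain ⟨v, hv, hsup⟩ := exists_support_of_mem_frontier hK.strictConvex.convex ⟨0, hK.zero_mem⟩ hx
  have hbt := mem_boundaryTangent_iff hcl hsmooth hx hv hsup
  have hker : ∀ u, sympl u v = 0 → sympl d u = 0 := fun u hu => by
    rw [sympl_eq_symplecticForm]
    exact hd.2 u ((hbt u).2 hu)
  -- The vector `w` complements the kernel of `sympl · v`. As `sympl d` vanishes on that kernel, its
  -- value at `w` determines `d` as a multiple of `v`.
  obtain ⟨w, hw⟩ : ∃ w, sympl w v = 1 := by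
    obtain ⟨z, hz⟩ : ∃ z, sympl z v ≠ 0 := by
      by_contra hn
      push Not at hn
      exact hv (eq_zero_of_sympl_left hn)
    refine ⟨(sympl z v)⁻¹ • z, ?_⟩
    rw [map_smul, smul_apply, smul_eq_mul, inv_mul_cancel₀ hz]
  set s := sympl d w
  have hdv : d = (-s) • v := by
    refine sub_eq_zero.1 (eq_zero_of_sympl_right fun y => ?_)
    have h1 := hker (y - (sympl y v) • w) (by
      rw [map_sub, map_smul, sub_apply, smul_apply, hw, smul_eq_mul, mul_one, sub_self])
    rw [map_sub, map_smul, smul_eq_mul] at h1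
    rw [map_sub, map_smul, sub_apply, smul_apply, smul_eq_mul, sympl_swap v y]
    linarith
  have hmax : ∀ r : ℝ, 0 ≤ r → sympl x (r • v) = suppFun K (r • v) := fun r hr => by
    rw [hK.suppFun_smul hr, hK.suppFun_eq hxK hsup, map_smul, smul_eq_mul]
  rcases le_total 0 (-s) with hs | hs
  · left
    rw [hdv]
    exact hmax _ hs
  · right
    rw [hdv, ← neg_smul]
    exact hmax _ (by linarith)

/-- The form `p dq` differs from `(p dq - q dp) / 2` by the exact form `d(pq) / 2`, which integrates
to zero over a closed curve. -/
lemma action_eq {T : ℝ} (hT : 0 < T) {η d : ℝ → CSpace n} (hd : Continuous d)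
    (hη : ∀ t ∈ Icc 0 T, HasDerivWithinAt η (d t) (Icc 0 T) t) (hclosed : η 0 = η T) :
    action T η = (∫ t in (0 : ℝ)..T, sympl (η t) (d t)) / 2 := by
  have hηc : ContinuousOn η (uIcc 0 T) := by
    rw [uIcc_of_le hT.le]
    exact fun t ht => (hη t ht).continuousWithinAt
  have hcoord : ∀ L M : CSpace n →L[ℝ] ℝ,
      IntervalIntegrable (fun t => L (η t) * M (d t)) volume 0 T := fun L M =>
    ((L.continuous.comp_continuousOn hηc).mul
      (M.continuous.comp hd).continuousOn).intervalIntegrable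
  have hparts : ∀ j : Fin n, ∫ t in (0 : ℝ)..T,
      (reCoord j (η t) * imCoord j (d t) + imCoord j (η t) * reCoord j (d t)) = 0 := by
    intro j
    have h := intervalIntegral.integral_eq_sub_of_hasDerivAt_of_le hT.le
      (f := fun t => reCoord j (η t) * imCoord j (η t))
      (f' := fun t => reCoord j (η t) * imCoord j (d t) + imCoord j (η t) * reCoord j (d t))
      (by
        rw [uIcc_of_le hT.le] at hηc
        exact ((reCoord j).continuous.comp_continuousOn hηc).mul
          ((imCoord j).continuous.comp_continuousOn hηc))
      (fun t ht => by
        have hd' := (hη t (Ioo_subset_Icc_self ht)).hasDerivAt (Icc_mem_nhds ht.1 ht.2)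
        have h1 := ((reCoord j).hasFDerivAt (x := η t)).comp_hasDerivAt t hd'
        have h2 := ((imCoord j).hasFDerivAt (x := η t)).comp_hasDerivAt t hd'
        refine (h1.mul h2).congr_deriv ?_
        simp only [Function.comp_apply]
        ring)
      ((hcoord _ _).add (hcoord _ _))
    rw [h, hclosed, sub_self]
  have h1 : action T η = ∫ t in (0 : ℝ)..T, ∑ j, reCoord j (η t) * imCoord j (d t) := by
    rw [action]
    apply intervalIntegral.integral_congr
    intro t ht
    rw [uIcc_of_le hT.le] at ht
    simp only
    rw [(hη t ht).derivWithin (uniqueDiffOn_Icc hT t ht)]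
    rfl
  rw [h1]
  simp only [sympl_eq_sum_coord]
  rw [intervalIntegral.integral_finsetSum fun j _ => hcoord _ _,
    intervalIntegral.integral_finsetSum fun j _ => (hcoord _ _).sub (hcoord _ _), Finset.sum_div]
  refine Finset.sum_congr rfl fun j _ => ?_
  have h2 := hparts j
  rw [intervalIntegral.integral_add (hcoord _ _) (hcoord _ _)] at h2
  rw [intervalIntegral.integral_sub (hcoord _ _) (hcoord _ _)]
  linarith

namespace IsPosLoop

variable {T : ℝ} {η d : ℝ → CSpace n}

lemma isMax (hK : IsSmoothBody K) (h : IsPosLoop K T η d) {t : ℝ} (ht : t ∈ Icc 0 T) :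
    ∀ y ∈ K, sympl y (d t) ≤ sympl (η t) (d t) := fun y hy => by
  rw [h.support t ht]
  exact hK.le_suppFun _ hy

lemma isClosedCharacteristic (hK : IsSmoothBody K) (hsmooth : HasSmoothBoundary K)
    (h : IsPosLoop K T η d) : IsClosedCharacteristic K T η := by
  have hder : ∀ t ∈ Icc 0 T, derivWithin η (Icc 0 T) t = d t := fun t ht =>
    (h.hasDeriv t ht).derivWithin (uniqueDiffOn_Icc h.pos t ht)
  have hfr : ∀ t ∈ Icc 0 T, η t ∈ frontier K := fun t ht =>
    mem_frontier_of_support (h.mem t ht) (h.ne_zero t ht) (h.isMax hK ht)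
  refine ⟨h.pos, ?_, h.closed, hfr, fun t ht => by rw [hder t ht]; exact h.ne_zero t ht,
    fun t ht => ?_⟩
  · rw [contDiffOn_one_iff_derivWithin (uniqueDiffOn_Icc h.pos)]
    exact ⟨fun t ht => (h.hasDeriv t ht).differentiableWithinAt,
      h.continuous.continuousOn.congr hder⟩
  · have hbt := mem_boundaryTangent_iff hK.compact.isClosed hsmooth (hfr t ht) (h.ne_zero t ht)
      (h.isMax hK ht)
    rw [hder t ht]
    refine ⟨(hbt _).2 (sympl_self _), fun u hu => ?_⟩
    rw [← sympl_eq_symplecticForm, sympl_swap, (hbt u).1 hu, neg_zero]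

lemma action_eq_half_length (h : IsPosLoop K T η d) :
    action T η = (∫ t in (0 : ℝ)..T, suppFun K (d t)) / 2 := by
  rw [action_eq h.pos h.continuous h.hasDeriv h.closed]
  congr 1
  apply intervalIntegral.integral_congr
  intro t ht
  rw [uIcc_of_le h.pos.le] at ht
  exact h.support t ht

lemma length_pos (hK : IsSmoothBody K) (h : IsPosLoop K T η d) :
    0 < ∫ t in (0 : ℝ)..T, suppFun K (d t) :=
  intervalIntegral.intervalIntegral_pos_of_pos_on
    ((hK.continuous_suppFun.comp h.continuous).intervalIntegrable 0 T)
    (fun t ht => hK.suppFun_pos (h.ne_zero t (Ioo_subset_Icc_self ht))) h.pos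

end IsPosLoop

/-- Every closed characteristic can be traversed in the positive direction. -/
theorem IsClosedCharacteristic.exists_posLoop (hK : IsSmoothBody K) (hsmooth : HasSmoothBoundary K)
    {T : ℝ} {γ : ℝ → CSpace n} (hγ : IsClosedCharacteristic K T γ) :
    ∃ η d : ℝ → CSpace n, IsPosLoop K T η d ∧ η '' Icc 0 T = γ '' Icc 0 T ∧
      ∫ t in (0 : ℝ)..T, suppFun K (d t) = 2 * |action T γ| := by
  have hT := hγ.pos
  have hcd := (contDiffOn_one_iff_derivWithin (uniqueDiffOn_Icc hT)).1 hγ.contDiffOn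
  set d : ℝ → CSpace n :=
    IccExtend hT.le ((Icc 0 T).domRestrict (derivWithin γ (Icc 0 T))) with hd
  have hdc : Continuous d := (continuousOn_iff_continuous_domRestrict.1 hcd.2).Icc_extend'
  have hdd : ∀ t ∈ Icc 0 T, d t = derivWithin γ (Icc 0 T) t := fun t ht => IccExtend_of_mem _ _ ht
  have hder : ∀ t ∈ Icc 0 T, HasDerivWithinAt γ (d t) (Icc 0 T) t := fun t ht => by
    rw [hdd t ht]
    exact (hcd.1 t ht).hasDerivWithinAt
  have hne : ∀ t ∈ Icc 0 T, d t ≠ 0 := fun t ht => by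
    rw [hdd t ht]
    exact hγ.regular t ht
  have hK' : ∀ t ∈ Icc 0 T, γ t ∈ K := fun t ht =>
    hK.compact.isClosed.frontier_subset (hγ.mem_frontier t ht)
  have halt : ∀ t ∈ Icc 0 T, sympl (γ t) (d t) = suppFun K (d t) ∨
      sympl (γ t) (-d t) = suppFun K (-d t) := fun t ht =>
    support_of_mem_characteristicKernel hK hsmooth (hγ.mem_frontier t ht)
      (by rw [hdd t ht]; exact hγ.tangent t ht)
  have hF : ContinuousOn (fun t => sympl (γ t) (d t)) (Icc 0 T) := fun t ht =>
    (isBoundedBilinearMap_apply.continuous.tendsto (sympl (γ t), d t)).comp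
      (((sympl.continuous.tendsto (γ t)).comp (hder t ht).continuousWithinAt).prodMk_nhds
        hdc.continuousWithinAt)
  have hF0 : ∀ t ∈ Icc 0 T, sympl (γ t) (d t) ≠ 0 := fun t ht h0 => by
    rcases halt t ht with h | h
    · exact (hK.suppFun_pos (hne t ht)).ne' (by rw [← h, h0])
    · exact (hK.suppFun_pos (neg_ne_zero.2 (hne t ht))).ne' (by rw [← h, map_neg, h0, neg_zero])
  have hact := action_eq hT hdc hder hγ.closed
  -- The pairing is continuous and never zero on an interval, so the direction of travel cannot
  -- switch; a negative sign is repaired by reversing time.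
  have hsign : (∀ t ∈ Icc 0 T, 0 < sympl (γ t) (d t)) ∨ ∀ t ∈ Icc 0 T, sympl (γ t) (d t) < 0 := by
    by_contra hn
    push Not at hn
    obtain ⟨⟨s, hs, hs'⟩, t, ht, ht'⟩ := hn
    obtain ⟨z, hz, hz'⟩ := isPreconnected_Icc.intermediate_value hs ht hF ⟨hs', ht'⟩
    exact hF0 z hz hz'
  rcases hsign with hpos | hneg
  · have hsup : ∀ t ∈ Icc 0 T, sympl (γ t) (d t) = suppFun K (d t) := fun t ht => by
      refine (halt t ht).resolve_right fun h => ?_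
      have h1 := hK.suppFun_nonneg (-d t)
      have h2 := hpos t ht
      rw [← h, map_neg] at h1
      linarith
    have hloop : IsPosLoop K T γ d := ⟨hT, hdc, hder, hγ.closed, hK', hsup, hne⟩
    refine ⟨γ, d, hloop, rfl, ?_⟩
    have h1 := hloop.action_eq_half_length
    have h2 := hloop.length_pos hK
    rw [abs_of_pos (by rw [h1]; positivity), h1]
    ring
  · have hsup : ∀ t ∈ Icc 0 T, sympl (γ t) (-d t) = suppFun K (-d t) := fun t ht => by
      refine (halt t ht).resolve_left fun h => ?_
      have h1 := hK.suppFun_nonneg (d t)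
      have h2 := hneg t ht
      rw [← h] at h1
      linarith
    have hmem : ∀ t ∈ Icc 0 T, T - t ∈ Icc 0 T := fun t ht =>
      ⟨by linarith [ht.2], by linarith [ht.1]⟩
    have hloop : IsPosLoop K T (fun t => γ (T - t)) (fun t => -d (T - t)) := by
      refine ⟨hT, by fun_prop, fun t ht => ?_, ?_, fun t ht => hK' _ (hmem t ht),
        fun t ht => hsup _ (hmem t ht), fun t ht => neg_ne_zero.2 (hne _ (hmem t ht))⟩
      · have h1 : HasDerivWithinAt (fun t => T - t) (-1) (Icc 0 T) t := by
          simpa using (hasDerivWithinAt_id t (Icc 0 T)).const_sub T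
        have h2 := (hder _ (hmem t ht)).scomp t h1 hmem
        rw [neg_one_smul] at h2
        exact h2
      · simp [hγ.closed]
    refine ⟨_, _, hloop, ?_, ?_⟩
    · ext x
      constructor
      · rintro ⟨t, ht, rfl⟩
        exact ⟨_, hmem t ht, rfl⟩
      · rintro ⟨t, ht, rfl⟩
        exact ⟨T - t, hmem t ht, by simp⟩
    · rw [intervalIntegral.integral_comp_sub_left (fun t => suppFun K (-d t)), sub_self, sub_zero]
      have h1 : ∫ t in (0 : ℝ)..T, suppFun K (-d t) = -∫ t in (0 : ℝ)..T, sympl (γ t) (d t) := by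
        rw [← intervalIntegral.integral_neg]
        apply intervalIntegral.integral_congr
        intro t ht
        rw [uIcc_of_le hT.le] at ht
        simp only
        rw [← hsup t ht, map_neg]
      have h2 : 0 ≤ ∫ t in (0 : ℝ)..T, suppFun K (-d t) :=
        intervalIntegral.integral_nonneg hT.le fun t _ => hK.suppFun_nonneg _
      rw [hact, abs_of_nonpos (by linarith), h1]
      ring

end Geometry

/-! ### Discrete isoperimetric inequality by Fourier analysis on `ZMod m` -/

section Polygon

-- Parseval's identity, from Fourier inversion `dft_dft`.
open ZMod in
lemma sum_conj_dft_mul_dft {m : ℕ} [NeZero m] (a b : ZMod m → ℂ) :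
    ∑ r, (starRingEnd ℂ) (dft a r) * dft b r = m * ∑ j, (starRingEnd ℂ) (a j) * b j := by
  have hconj : ∀ r, (starRingEnd ℂ) (dft a r)
      = ∑ j, stdAddChar (j * r) * (starRingEnd ℂ) (a j) := by
    intro r
    rw [dft_apply, map_sum]
    refine Finset.sum_congr rfl fun j _ => ?_
    rw [smul_eq_mul, map_mul, ← AddChar.map_neg_eq_conj, neg_neg]
  have hdft : ∀ j, ∑ r, stdAddChar (j * r) * dft b r = m * b j := by
    intro j
    have h := congrFun (dft_dft b) (-j)
    rw [dft_apply, neg_neg, smul_eq_mul] at h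
    rw [← h]
    refine Finset.sum_congr rfl fun r _ => ?_
    rw [smul_eq_mul, mul_neg, neg_neg, mul_comm j]
  calc ∑ r, (starRingEnd ℂ) (dft a r) * dft b r
      = ∑ r, ∑ j, (starRingEnd ℂ) (a j) * (stdAddChar (j * r) * dft b r) := by
        refine Finset.sum_congr rfl fun r _ => ?_
        rw [hconj, Finset.sum_mul]
        exact Finset.sum_congr rfl fun j _ => by ring
    _ = ∑ j, (starRingEnd ℂ) (a j) * (m * b j) := by
        rw [Finset.sum_comm]
        exact Finset.sum_congr rfl fun j _ => by rw [← Finset.mul_sum, hdft]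
    _ = _ := by
        rw [Finset.mul_sum]
        exact Finset.sum_congr rfl fun j _ => by ring

open ZMod in
lemma dft_shift {m : ℕ} [NeZero m] (a : ZMod m → ℂ) (r : ZMod m) :
    dft (fun j => a (j + 1)) r = stdAddChar r * dft a r := by
  rw [dft_apply, dft_apply, Finset.mul_sum]
  refine Fintype.sum_equiv (Equiv.addRight (1 : ZMod m)) _ _ fun j => ?_
  rw [Equiv.coe_addRight, smul_eq_mul, smul_eq_mul, ← mul_assoc, ← AddChar.map_add_eq_mul]
  congr 2
  ring

/-- With half angles `h = π / m` and `k = r h` this is, for `r > 0`, the monotonicity of the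
cotangent in denominator-free form: it reduces to `sin h * sin k * sin (k - h) ≥ 0` with `h ≤ k ≤
π`. -/
lemma sin_mul_le_sin_mul (m r : ℕ) (hm : 1 < m) (hr : r < m) :
    Real.sin (2 * Real.pi * r / m) * (2 - 2 * Real.cos (2 * Real.pi / m))
      ≤ Real.sin (2 * Real.pi / m) * (2 - 2 * Real.cos (2 * Real.pi * r / m)) := by
  have hm0 : (0 : ℝ) < m := by exact_mod_cast (by omega : 0 < m)
  set h := Real.pi / m with hh
  set k := r * h with hk
  have e1 : 2 * Real.pi * r / m = 2 * k := by rw [hk, hh]; ring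
  have e2 : 2 * Real.pi / m = 2 * h := by rw [hh]; ring
  have hpi := Real.pi_pos
  have hm1 : (1 : ℝ) < m := by exact_mod_cast hm
  have hh0 : 0 < h := by positivity
  have hhpi : h ≤ Real.pi := div_le_self hpi.le hm1.le
  have hmh : m * h = Real.pi := by rw [hh]; field_simp
  rw [e1, e2, Real.sin_two_mul, Real.sin_two_mul, Real.cos_two_mul', Real.cos_two_mul']
  rcases Nat.eq_zero_or_pos r with rfl | hr0
  · simp [hk]
  have hr1 : (1 : ℝ) ≤ r := by exact_mod_cast hr0
  have hrm : (r : ℝ) < m := by exact_mod_cast hr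
  have hkh : h ≤ k := le_mul_of_one_le_left hh0.le hr1
  have hkpi : k ≤ Real.pi := by
    rw [← hmh]
    exact mul_le_mul_of_nonneg_right hrm.le hh0.le
  have s1 : 0 ≤ Real.sin h := Real.sin_nonneg_of_nonneg_of_le_pi hh0.le hhpi
  have s2 : 0 ≤ Real.sin k := Real.sin_nonneg_of_nonneg_of_le_pi (hh0.le.trans hkh) hkpi
  have s3 : 0 ≤ Real.sin (k - h) :=
    Real.sin_nonneg_of_nonneg_of_le_pi (by linarith) (by linarith)
  rw [Real.sin_sub] at s3
  have c1 := Real.sin_sq_add_cos_sq h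
  have c2 := Real.sin_sq_add_cos_sq k
  have key := mul_nonneg (mul_nonneg s1 s2) s3
  have f1 : 2 - 2 * (Real.cos h ^ 2 - Real.sin h ^ 2) = 4 * Real.sin h ^ 2 := by linarith
  have f2 : 2 - 2 * (Real.cos k ^ 2 - Real.sin k ^ 2) = 4 * Real.sin k ^ 2 := by linarith
  rw [f1, f2]
  nlinarith [key]

lemma exp_im (θ : ℝ) : (Complex.exp (θ * Complex.I)).im = Real.sin θ :=
  Complex.exp_ofReal_mul_I_im θ

lemma normSq_exp_sub_one (θ : ℝ) :
    Complex.normSq (Complex.exp (θ * Complex.I) - 1) = 2 - 2 * Real.cos θ := by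
  rw [Complex.normSq_apply, Complex.sub_re, Complex.sub_im, Complex.exp_ofReal_mul_I_re,
    Complex.exp_ofReal_mul_I_im, Complex.one_re, Complex.one_im]
  linear_combination Real.sin_sq_add_cos_sq θ

/-- The area of the regular polygon with unit edges, up to normalization. -/
noncomputable def regularPolygonConst (m : ℕ) : ℝ :=
  Real.sin (2 * Real.pi / m) / (2 - 2 * Real.cos (2 * Real.pi / m))

lemma two_sub_two_cos_pos {m : ℕ} (hm : 1 < m) : 0 < 2 - 2 * Real.cos (2 * Real.pi / m) := by
  have hm0 : (0 : ℝ) < m := by exact_mod_cast (by omega : 0 < m)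
  have hm1 : (1 : ℝ) < m := by exact_mod_cast hm
  have h1 : 2 * Real.pi / m = 2 * (Real.pi / m) := by ring
  have h2 : 0 < Real.sin (Real.pi / m) :=
    Real.sin_pos_of_pos_of_lt_pi (by positivity) (div_lt_self Real.pi_pos hm1)
  have h3 := Real.sin_sq_add_cos_sq (Real.pi / m)
  rw [h1, Real.cos_two_mul']
  nlinarith [pow_pos h2 2]

open ZMod in
lemma stdAddChar_im_le {m : ℕ} [NeZero m] (hm : 1 < m) (r : ZMod m) :
    (stdAddChar r : ℂ).im ≤ regularPolygonConst m * Complex.normSq (stdAddChar r - 1) := by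
  have h : (stdAddChar r : ℂ) = Complex.exp (((2 * Real.pi * r.val / m : ℝ) : ℂ) * Complex.I) := by
    have := stdAddChar_coe (N := m) (r.val : ℤ)
    rw [Int.cast_natCast, natCast_zmod_val] at this
    rw [this]
    congr 1
    push_cast
    ring
  rw [h, exp_im, normSq_exp_sub_one, regularPolygonConst, div_mul_eq_mul_div,
    le_div_iff₀ (two_sub_two_cos_pos hm)]
  exact sin_mul_le_sin_mul m r.val hm (val_lt r)

open ZMod in
/-- The isoperimetric inequality for closed polygons in the plane. -/
lemma polygon_isoperimetric {m : ℕ} [NeZero m] (hm : 1 < m) (a : ZMod m → ℂ) :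
    ∑ j, ((starRingEnd ℂ) (a j) * a (j + 1)).im
      ≤ regularPolygonConst m * ∑ j, Complex.normSq (a (j + 1) - a j) := by
  have hm0 : (0 : ℝ) < m := by exact_mod_cast (by omega : 0 < m)
  have h1 := sum_conj_dft_mul_dft a (fun j => a (j + 1))
  have h2 := sum_conj_dft_mul_dft (fun j => a (j + 1) - a j) (fun j => a (j + 1) - a j)
  -- Shift and difference are both diagonal in Fourier space, so the inequality reduces to
  -- `stdAddChar_im_le` mode by mode.
  have hd : ∀ r, dft (fun j => a (j + 1) - a j) r = (stdAddChar r - 1) * dft a r := by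
    intro r
    have : (fun j => a (j + 1) - a j) = (fun j => a (j + 1)) - a := rfl
    rw [this, map_sub, Pi.sub_apply, dft_shift]
    ring
  simp_rw [dft_shift] at h1
  simp_rw [hd, ← Complex.normSq_eq_conj_mul_self] at h2
  have h1' : ∑ r, (stdAddChar r : ℂ).im * Complex.normSq (dft a r)
      = m * ∑ j, ((starRingEnd ℂ) (a j) * a (j + 1)).im := by
    have h := congrArg Complex.im h1
    rw [Complex.im_sum, ← Complex.ofReal_natCast, Complex.im_ofReal_mul, Complex.im_sum] at h
    rw [← h]
    refine Finset.sum_congr rfl fun r _ => ?_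
    rw [mul_left_comm, ← Complex.normSq_eq_conj_mul_self, Complex.im_mul_ofReal]
  have h2' : ∑ r, Complex.normSq (stdAddChar r - 1) * Complex.normSq (dft a r)
      = m * ∑ j, Complex.normSq (a (j + 1) - a j) := by
    simp_rw [map_mul] at h2
    exact_mod_cast h2
  have h3 : m * ∑ j, ((starRingEnd ℂ) (a j) * a (j + 1)).im
      ≤ m * (regularPolygonConst m * ∑ j, Complex.normSq (a (j + 1) - a j)) := by
    rw [mul_left_comm, ← h1', ← h2', Finset.mul_sum]
    refine Finset.sum_le_sum fun r _ => ?_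
    rw [← mul_assoc]
    exact mul_le_mul_of_nonneg_right (stdAddChar_im_le hm r) (Complex.normSq_nonneg _)
  exact le_of_mul_le_mul_left h3 hm0

lemma sum_zmod_eq_sum_range {M : Type*} [AddCommMonoid M] {m : ℕ} [NeZero m] (f : ℕ → M) :
    ∑ x : ZMod m, f x.val = ∑ j ∈ Finset.range m, f j := by
  cases m with
  | zero => exact absurd rfl (NeZero.ne 0)
  | succ k => exact (Finset.sum_range f).symm

lemma val_add_one_or {m : ℕ} [NeZero m] (hm : 1 < m) (x : ZMod m) :
    (x + 1).val = x.val + 1 ∨ (x.val + 1 = m ∧ (x + 1).val = 0) := by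
  have : Fact (1 < m) := ⟨hm⟩
  rcases lt_or_ge (x.val + (1 : ZMod m).val) m with h | h
  · left
    rw [ZMod.val_add_of_lt h, ZMod.val_one]
  · right
    have h1 := ZMod.val_add_val_of_le h
    have h2 := ZMod.val_lt x
    rw [ZMod.val_one] at h h1
    omega

lemma sympl_eq_sum_im {n : ℕ} (u v : CSpace n) :
    sympl u v = ∑ i, ((starRingEnd ℂ) (u i) * v i).im := by
  rw [sympl_apply]
  refine Finset.sum_congr rfl fun i _ => ?_
  rw [Complex.mul_im, Complex.conj_re, Complex.conj_im]
  ring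

lemma norm_sq_eq_sum_normSq {n : ℕ} (u : CSpace n) : ‖u‖ ^ 2 = ∑ i, Complex.normSq (u i) := by
  rw [EuclideanSpace.norm_sq_eq]
  exact Finset.sum_congr rfl fun i _ => Complex.sq_norm _

/-- The isoperimetric inequality for closed polygons in `ℂⁿ`. -/
lemma sum_sympl_le_of_closed {n m : ℕ} (hm : 1 < m) (e : ℕ → CSpace n)
    (he : ∑ j ∈ Finset.range m, e j = 0) :
    ∑ j ∈ Finset.range m, sympl (∑ k ∈ Finset.range j, e k) (e j)
      ≤ regularPolygonConst m * ∑ j ∈ Finset.range m, ‖e j‖ ^ 2 := by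
  have : NeZero m := ⟨by omega⟩
  set A : ℕ → CSpace n := fun j => ∑ k ∈ Finset.range j, e k with hA
  set a : ZMod m → CSpace n := fun x => A x.val with ha
  -- Because the edges sum to zero, the vertices wrap around and define a function on `ZMod m`.
  have hnext : ∀ x : ZMod m, a (x + 1) = A (x.val + 1) := by
    intro x
    rcases val_add_one_or hm x with h | ⟨h, h'⟩
    · simp only [ha, h]
    · simp only [ha, h', h, hA, Finset.range_zero, Finset.sum_empty, he]
  have hdiff : ∀ j, e j = A (j + 1) - A j := fun j => by
    simp only [hA, Finset.sum_range_succ, add_sub_cancel_left]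
  have h1 : ∑ j ∈ Finset.range m, sympl (A j) (e j) = ∑ x : ZMod m, sympl (a x) (a (x + 1)) := by
    rw [← sum_zmod_eq_sum_range]
    refine Finset.sum_congr rfl fun x _ => ?_
    rw [hnext, hdiff, map_sub, sympl_self, sub_zero]
  have h2 : ∑ j ∈ Finset.range m, ‖e j‖ ^ 2 = ∑ x : ZMod m, ‖a (x + 1) - a x‖ ^ 2 := by
    rw [← sum_zmod_eq_sum_range]
    refine Finset.sum_congr rfl fun x _ => ?_
    rw [hnext, hdiff]
  rw [h1, h2]
  simp_rw [sympl_eq_sum_im, norm_sq_eq_sum_normSq]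
  rw [Finset.sum_comm, Finset.sum_comm (f := fun x i => Complex.normSq _), Finset.mul_sum]
  exact Finset.sum_le_sum fun i _ => polygon_isoperimetric hm fun x => a x i

lemma sympl_complex_smul {n : ℕ} (c c' : ℂ) (e : CSpace n) :
    sympl (c • e) (c' • e) = ((starRingEnd ℂ) c * c').im * ‖e‖ ^ 2 := by
  rw [sympl_eq_sum_im, norm_sq_eq_sum_normSq, Finset.mul_sum]
  refine Finset.sum_congr rfl fun i _ => ?_
  simp only [PiLp.smul_apply, smul_eq_mul, Complex.mul_im, Complex.mul_re, Complex.conj_re,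
    Complex.conj_im, Complex.normSq_apply, map_mul]
  ring

/-- The primitive root of unity of smallest positive argument. -/
noncomputable def rootOfUnity (m : ℕ) : ℂ :=
  Complex.exp (((2 * Real.pi / m : ℝ) : ℂ) * Complex.I)

lemma isPrimitiveRoot_rootOfUnity {m : ℕ} (hm : m ≠ 0) : IsPrimitiveRoot (rootOfUnity m) m := by
  have h := Complex.isPrimitiveRoot_exp m hm
  convert h using 1
  rw [rootOfUnity]
  congr 1
  push_cast
  ring

/-- The equality case of `sum_sympl_le_of_closed`. The partial sums are geometric, the `j`-th term
is `(1 - w ^ j) / (conj w - 1)`, and the powers of `w` cancel in the sum over `j`. -/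
lemma sum_sympl_rotate {n m : ℕ} (hm : 1 < m) (e : CSpace n) :
    ∑ j ∈ Finset.range m, sympl (∑ k ∈ Finset.range j, rootOfUnity m ^ k • e)
      (rootOfUnity m ^ j • e) = m * regularPolygonConst m * ‖e‖ ^ 2 := by
  have hroot := isPrimitiveRoot_rootOfUnity (m := m) (by omega)
  set w := rootOfUnity m with hw
  have hw1 : w ≠ 1 := hroot.ne_one hm
  have hww : (starRingEnd ℂ) w * w = 1 := by
    rw [← Complex.normSq_eq_conj_mul_self, Complex.normSq_eq_norm_sq, hroot.norm'_eq_one (by omega)]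
    norm_num
  have hc1 : (starRingEnd ℂ) w - 1 ≠ 0 := by
    rw [sub_ne_zero]
    intro h
    apply hw1
    have := congrArg (starRingEnd ℂ) h
    simpa using this
  have hsum : ∑ j ∈ Finset.range m, (starRingEnd ℂ) (∑ k ∈ Finset.range j, w ^ k) * w ^ j
      = m * ((starRingEnd ℂ) w - 1)⁻¹ := by
    have h1 : ∀ j, (starRingEnd ℂ) (∑ k ∈ Finset.range j, w ^ k) * w ^ j
        = (1 - w ^ j) * ((starRingEnd ℂ) w - 1)⁻¹ := by
      intro j
      rw [eq_mul_inv_iff_mul_eq₀ hc1, map_sum]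
      simp_rw [map_pow]
      rw [mul_right_comm, geom_sum_mul, sub_mul, ← mul_pow, hww, one_pow, one_mul]
    simp_rw [h1]
    rw [← Finset.sum_mul, Finset.sum_sub_distrib, hroot.geom_sum_eq_zero hm]
    simp
  have him : (((starRingEnd ℂ) w - 1)⁻¹).im = regularPolygonConst m := by
    have h1 : (starRingEnd ℂ) w - 1 = (starRingEnd ℂ) (w - 1) := by simp
    rw [Complex.inv_im, h1, Complex.normSq_conj, Complex.conj_im, neg_neg, Complex.sub_im,
      Complex.one_im, sub_zero, hw, rootOfUnity, exp_im, normSq_exp_sub_one, regularPolygonConst]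
  simp_rw [← Finset.sum_smul, sympl_complex_smul]
  rw [← Finset.sum_mul, ← Complex.im_sum, hsum, ← Complex.ofReal_natCast, Complex.im_ofReal_mul,
    him]

/-- Rotating each edge of a closed polygon does not decrease the total area on average. -/
theorem polygon_symmetrization {n m : ℕ} (hm : 1 < m) (e : ℕ → CSpace n)
    (he : ∑ j ∈ Finset.range m, e j = 0) :
    m * ∑ j ∈ Finset.range m, sympl (∑ k ∈ Finset.range j, e k) (e j)
      ≤ ∑ i ∈ Finset.range m, ∑ j ∈ Finset.range m,
        sympl (∑ k ∈ Finset.range j, rootOfUnity m ^ k • e i) (rootOfUnity m ^ j • e i) := by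
  simp_rw [sum_sympl_rotate hm]
  rw [← Finset.mul_sum, mul_assoc]
  exact mul_le_mul_of_nonneg_left (sum_sympl_le_of_closed hm e he) (Nat.cast_nonneg m)

end Polygon

/-! ### Constant speed periodic parametrization -/

/-- A closed characteristic parametrized by `ℝ / ℤ` with constant speed `L`, in the positive
direction. -/
structure IsPeriodicLoop {n : ℕ} (K : Set (CSpace n)) (L : ℝ) (ζ v : ℝ → CSpace n) : Prop where
  pos : 0 < L
  continuous : Continuous v
  hasDerivAt : ∀ t, HasDerivAt ζ (v t) t
  periodic : Function.Periodic ζ 1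
  periodic_velocity : Function.Periodic v 1
  suppFun_eq : ∀ t, suppFun K (v t) = L
  suppGrad_eq : ∀ t, suppGrad K (v t) = L • ζ t

section Reparametrization

variable {n : ℕ} {K : Set (CSpace n)}

/-- Periodic extension of a constant speed closed characteristic on the unit interval. -/
lemma exists_periodicLoop_of_unit (hK : IsSmoothBody K) {L : ℝ} (hL : 0 < L) {ζ v : ℝ → CSpace n}
    (hv : Continuous v) (hder : ∀ t, HasDerivAt ζ (v t) t) (hclosed : ζ 0 = ζ 1)
    (hg : ∀ t ∈ Icc (0 : ℝ) 1, suppFun K (v t) = L)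
    (hX : ∀ t ∈ Icc (0 : ℝ) 1, suppGrad K (v t) = L • ζ t) :
    ∃ ζ' v' : ℝ → CSpace n, IsPeriodicLoop K L ζ' v' ∧ ζ' '' Icc 0 1 = ζ '' Icc 0 1 := by
  have h0 : (0 : ℝ) ∈ Icc (0 : ℝ) 1 := ⟨le_rfl, zero_le_one⟩
  have h1 : (1 : ℝ) ∈ Icc (0 : ℝ) 1 := ⟨zero_le_one, le_rfl⟩
  have hfr : ∀ t : ℝ, Int.fract t ∈ Icc (0 : ℝ) 1 := fun t =>
    ⟨Int.fract_nonneg t, (Int.fract_lt_one t).le⟩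
  -- The velocity closes up as well, because it is determined by the position through the injective
  -- `suppGrad K`; hence its periodic extension is continuous.
  have hvclosed : v 0 = v 1 := hK.injective_suppGrad (by rw [hX 0 h0, hX 1 h1, hclosed])
  set v' : ℝ → CSpace n := v ∘ Int.fract with hv'
  have hv'c : Continuous v' := hv.continuousOn.comp_fract'' hvclosed
  have hper : Function.Periodic v' 1 := fun t => by simp [hv', Int.fract_add_one]
  have hint : ∀ t ∈ Icc (0 : ℝ) 1, ∫ s in (0 : ℝ)..t, v' s = ζ t - ζ 0 := by
    intro t ht
    rw [← intervalIntegral.integral_eq_sub_of_hasDerivAt (fun s _ => hder s)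
      (hv.intervalIntegrable 0 t)]
    apply intervalIntegral.integral_congr_ae
    have hne : ∀ᵐ s : ℝ, s ≠ 1 := by simp [ae_iff]
    filter_upwards [hne] with s hs hmem
    rw [uIoc_of_le ht.1] at hmem
    have : s < 1 := lt_of_le_of_ne (hmem.2.trans ht.2) hs
    rw [hv', Function.comp_apply, Int.fract_eq_self.2 ⟨hmem.1.le, this⟩]
  set ζ' : ℝ → CSpace n := fun t => ζ 0 + ∫ s in (0 : ℝ)..t, v' s with hζ'
  have hζ'v : ∀ t, HasDerivAt ζ' (v' t) t := fun t =>
    (hv'c.integral_hasStrictDerivAt 0 t).hasDerivAt.const_add _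
  have hζ'per : Function.Periodic ζ' 1 := fun t => by
    have e1 := hper.intervalIntegral_add_eq t 0
    rw [zero_add, hint 1 h1, hclosed, sub_self] at e1
    simp only [hζ']
    rw [← intervalIntegral.integral_add_adjacent_intervals (hv'c.intervalIntegrable 0 t)
      (hv'c.intervalIntegrable t (t + 1)), e1, add_zero]
  have hζ'ζ : ∀ t ∈ Icc (0 : ℝ) 1, ζ' t = ζ t := fun t ht => by
    simp only [hζ']
    rw [hint t ht, add_sub_cancel]
  have hζ'fr : ∀ t, ζ' t = ζ (Int.fract t) := fun t => by
    rw [← hζ'ζ _ (hfr t), Int.fract]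
    have := hζ'per.sub_zsmul_eq (x := t) ⌊t⌋
    simpa using this.symm
  refine ⟨ζ', v', ⟨hL, hv'c, hζ'v, hζ'per, hper, fun t => hg _ (hfr t), fun t => ?_⟩, ?_⟩
  · rw [hζ'fr]
    exact hX _ (hfr t)
  · exact image_congr hζ'ζ

/-- Constant speed reparametrization. -/
theorem IsPosLoop.exists_periodicLoop (hK : IsSmoothBody K) {T : ℝ} {η d : ℝ → CSpace n}
    (h : IsPosLoop K T η d) : ∃ ζ v : ℝ → CSpace n,
      IsPeriodicLoop K (∫ t in (0 : ℝ)..T, suppFun K (d t)) ζ v ∧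
      ζ '' Icc 0 1 = η '' Icc 0 T := by
  have hT := h.pos
  set L := ∫ t in (0 : ℝ)..T, suppFun K (d t) with hLdef
  have hL : 0 < L := h.length_pos hK
  -- Constant extension beyond `[0, T]` makes the normalized length `σ` a bijection of the whole
  -- line, which avoids one-sided derivatives at the endpoints.
  set d' : ℝ → CSpace n := fun t => d (projIcc 0 T hT.le t) with hd'
  have hd'c : Continuous d' := h.continuous.comp (continuous_subtype_val.comp continuous_projIcc)
  have hd'd : ∀ t ∈ Icc 0 T, d' t = d t := fun t ht => by simp only [hd', projIcc_of_mem hT.le ht]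
  have hd'0 : ∀ t, d' t ≠ 0 := fun t => h.ne_zero _ (projIcc 0 T hT.le t).2
  set s : ℝ → ℝ := fun t => suppFun K (d' t) with hs
  have hsc : Continuous s := hK.continuous_suppFun.comp hd'c
  have hs0 : ∀ t, 0 < s t := fun t => hK.suppFun_pos (hd'0 t)
  obtain ⟨κ, hκ, hκs⟩ : ∃ κ : ℝ, 0 < κ ∧ ∀ t, κ ≤ s t := by
    obtain ⟨t₀, ht₀, hmin⟩ := isCompact_Icc.exists_isMinOn (nonempty_Icc.2 hT.le)
      hsc.continuousOn
    refine ⟨s t₀, hs0 t₀, fun t => ?_⟩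
    have h1 := hmin (projIcc 0 T hT.le t).2
    have h2 : s (projIcc 0 T hT.le t) = s t := by
      simp only [hs, hd', projIcc_val]
    rw [← h2]
    exact h1
  set σ : ℝ → ℝ := fun t => L⁻¹ * ∫ x in (0 : ℝ)..t, s x with hσ
  have hσd : ∀ t, HasDerivAt σ (L⁻¹ * s t) t := fun t =>
    (hsc.integral_hasStrictDerivAt 0 t).hasDerivAt.const_mul _
  have hσc : Continuous σ := continuous_iff_continuousAt.2 fun t => (hσd t).continuousAt
  have hσmono : StrictMono σ := strictMono_of_deriv_pos fun t => by
    rw [(hσd t).deriv]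
    exact mul_pos (inv_pos.2 hL) (hs0 t)
  have hκL : 0 < L⁻¹ * κ := mul_pos (inv_pos.2 hL) hκ
  -- The speed is bounded below by `κ`, so `σ` grows at least linearly and is surjective.
  have hlin : Monotone fun t => σ t - L⁻¹ * κ * t := by
    refine monotone_of_deriv_nonneg (fun t => ?_) fun t => ?_
    · exact ((hσd t).sub ((hasDerivAt_id t).const_mul _)).differentiableAt
    · have h1 := (hσd t).sub ((hasDerivAt_id t).const_mul (L⁻¹ * κ))
      have h2 : deriv (fun t => σ t - L⁻¹ * κ * t) t = L⁻¹ * s t - L⁻¹ * κ * 1 := h1.deriv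
      rw [h2, mul_one, sub_nonneg]
      exact mul_le_mul_of_nonneg_left (hκs t) (inv_pos.2 hL).le
  have hσ0 : σ 0 = 0 := by simp [hσ]
  have hσT : σ T = 1 := by
    simp only [hσ]
    rw [inv_mul_eq_one₀ hL.ne', hLdef]
    refine intervalIntegral.integral_congr fun t ht => ?_
    rw [uIcc_of_le hT.le] at ht
    simp only [hs, hd'd t ht]
  have hsurj : Function.Surjective σ := by
    refine hσc.surjective ?_ ?_
    · refine tendsto_atTop_mono' _ ?_ (tendsto_id.const_mul_atTop hκL)
      filter_upwards [eventually_ge_atTop 0] with t ht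
      have := hlin ht
      simp only [hσ0, mul_zero, sub_zero, id] at this ⊢
      linarith
    · refine tendsto_atBot_mono' _ ?_ (tendsto_id.const_mul_atBot hκL)
      filter_upwards [eventually_le_atBot 0] with t ht
      have := hlin ht
      simp only [hσ0, mul_zero, sub_zero, id] at this ⊢
      linarith
  set e : ℝ ≃o ℝ := hσmono.orderIsoOfSurjective σ hsurj with he
  set τ : ℝ → ℝ := fun u => e.symm u with hτ
  have hστ : ∀ u, σ (τ u) = u := fun u => e.apply_symm_apply u
  have hτσ : ∀ t, τ (σ t) = t := fun t => e.symm_apply_apply t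
  have hτc : Continuous τ := e.symm.continuous
  have hτd : ∀ u, HasDerivAt τ (L⁻¹ * s (τ u))⁻¹ u := fun u =>
    (hσd (τ u)).of_local_left_inverse hτc.continuousAt
      (mul_pos (inv_pos.2 hL) (hs0 _)).ne' (Eventually.of_forall hστ)
  have hτ0 : τ 0 = 0 := by rw [← hσ0, hτσ, hσ0]
  have hτ1 : τ 1 = T := by rw [← hσT, hτσ]
  have hτmono : StrictMono τ := e.symm.strictMono
  have hτmem : ∀ u ∈ Icc (0 : ℝ) 1, τ u ∈ Icc 0 T := fun u hu =>
    ⟨hτ0 ▸ hτmono.monotone hu.1, hτ1 ▸ hτmono.monotone hu.2⟩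
  set η' : ℝ → CSpace n := fun t => η 0 + ∫ x in (0 : ℝ)..t, d' x with hη'
  have hη'd : ∀ t, HasDerivAt η' (d' t) t := fun t =>
    (hd'c.integral_hasStrictDerivAt 0 t).hasDerivAt.const_add _
  have hη'η : ∀ t ∈ Icc 0 T, η' t = η t := by
    intro t ht
    have hsub : Icc 0 t ⊆ Icc 0 T := Icc_subset_Icc_right ht.2
    have h1 := intervalIntegral.integral_eq_sub_of_hasDerivAt_of_le ht.1 (f := η) (f' := d')
      (fun x hx => (h.hasDeriv x (hsub hx)).continuousWithinAt.mono hsub)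
      (fun x hx => by
        have hx' := hsub (Ioo_subset_Icc_self hx)
        rw [hd'd x hx']
        exact (h.hasDeriv x hx').hasDerivAt (Icc_mem_nhds hx.1 (hx.2.trans_le ht.2)))
      (hd'c.intervalIntegrable 0 t)
    simp only [hη']
    rw [h1, add_sub_cancel]
  set ζ : ℝ → CSpace n := fun u => η' (τ u) with hζ
  set v : ℝ → CSpace n := fun u => (L⁻¹ * s (τ u))⁻¹ • d' (τ u) with hv
  have hc0 : ∀ u, 0 < L⁻¹ * s (τ u) := fun u => mul_pos (inv_pos.2 hL) (hs0 _)
  have hvc : Continuous v :=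
    ((continuous_const.mul (hsc.comp hτc)).inv₀ fun u => (hc0 u).ne').smul (hd'c.comp hτc)
  have hζd : ∀ u, HasDerivAt ζ (v u) u := fun u => (hη'd (τ u)).scomp u (hτd u)
  have hg : ∀ u, suppFun K (v u) = L := fun u => by
    simp only [hv]
    rw [hK.suppFun_smul (inv_pos.2 (hc0 u)).le, mul_inv, inv_inv, mul_assoc]
    change L * ((s (τ u))⁻¹ * s (τ u)) = L
    rw [inv_mul_cancel₀ (hs0 _).ne', mul_one]
  have hv0 : ∀ u, v u ≠ 0 := fun u => smul_ne_zero (inv_pos.2 (hc0 u)).ne' (hd'0 _)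
  have hX : ∀ u ∈ Icc (0 : ℝ) 1, suppGrad K (v u) = L • ζ u := by
    intro u hu
    have hmem := hτmem u hu
    have hζη : ζ u = η (τ u) := hη'η _ hmem
    rw [suppGrad, hg, hζη]
    congr 1
    refine (hK.supportPt_unique (hv0 u) (h.mem _ hmem) ?_).symm
    simp only [hv]
    rw [map_smul, hK.suppFun_smul (inv_pos.2 (hc0 u)).le, hd'd _ hmem, h.support _ hmem,
      smul_eq_mul]
  have hclosed : ζ 0 = ζ 1 := by
    simp only [hζ, hτ0, hτ1]
    rw [hη'η 0 ⟨le_rfl, hT.le⟩, hη'η T ⟨hT.le, le_rfl⟩, h.closed]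
  obtain ⟨ζ', v', hloop, himg⟩ := exists_periodicLoop_of_unit hK hL hvc hζd hclosed
    (fun u _ => hg u) hX
  refine ⟨ζ', v', hloop, himg.trans ?_⟩
  ext x
  constructor
  · rintro ⟨u, hu, rfl⟩
    exact ⟨τ u, hτmem u hu, (hη'η _ (hτmem u hu)).symm⟩
  · rintro ⟨t, ht, rfl⟩
    refine ⟨σ t, ⟨hσ0 ▸ hσmono.monotone ht.1, hσT ▸ hσmono.monotone ht.2⟩, ?_⟩
    simp only [hζ]
    rw [hτσ, hη'η t ht]

end Reparametrization

namespace IsPeriodicLoop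

variable {n : ℕ} {K : Set (CSpace n)} {L : ℝ} {ζ v : ℝ → CSpace n}

lemma shift (h : IsPeriodicLoop K L ζ v) (t₀ : ℝ) :
    IsPeriodicLoop K L (fun t => ζ (t + t₀)) (fun t => v (t + t₀)) where
  pos := h.pos
  continuous := h.continuous.comp (continuous_add_const t₀)
  hasDerivAt t := (h.hasDerivAt (t + t₀)).comp_add_const t t₀
  periodic t := by
    simp only
    rw [add_right_comm, h.periodic]
  periodic_velocity t := by
    simp only
    rw [add_right_comm, h.periodic_velocity]
  suppFun_eq t := h.suppFun_eq _
  suppGrad_eq t := h.suppGrad_eq _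

lemma integral_eq (h : IsPeriodicLoop K L ζ v) (a b : ℝ) : ∫ t in a..b, v t = ζ b - ζ a :=
  intervalIntegral.integral_eq_sub_of_hasDerivAt (fun t _ => h.hasDerivAt t)
    (h.continuous.intervalIntegrable a b)

lemma integral_zero_one (h : IsPeriodicLoop K L ζ v) : ∫ t in (0 : ℝ)..1, v t = 0 := by
  have := h.periodic 0
  rw [zero_add] at this
  rw [h.integral_eq, this, sub_self]

lemma exists_norm_le (hK : IsSmoothBody K) (h : IsPeriodicLoop K L ζ v) :
    ∃ C : ℝ, ∀ t, ‖v t‖ ≤ C := by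
  obtain ⟨r, R, hr, -, hball, -⟩ := hK.exists_radii
  refine ⟨L / r, fun t => ?_⟩
  rw [le_div_iff₀ hr, mul_comm, ← h.suppFun_eq t]
  exact hK.suppFun_lower hr hball _

lemma isClosedVelocity (hK : IsSmoothBody K) (h : IsPeriodicLoop K L ζ v) : IsClosedVelocity v := by
  obtain ⟨C, hC⟩ := h.exists_norm_le hK
  exact ⟨MemLp.of_bound h.continuous.aestronglyMeasurable C (ae_of_all _ hC), h.integral_zero_one⟩

lemma sympl_eq (h : IsPeriodicLoop K L ζ v) (t : ℝ) : sympl (ζ t) (v t) = L := by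
  have h1 := congrArg (fun z => sympl z (v t)) (h.suppGrad_eq t)
  simp only [suppGrad, map_smul, smul_apply, smul_eq_mul] at h1
  rw [← suppFun, h.suppFun_eq] at h1
  exact (mul_left_cancel₀ h.pos.ne' h1).symm

/-- By `sympl_eq` the pairing of position and velocity is constantly `L`; the base point contributes
nothing because the curve is closed. -/
lemma area_eq (h : IsPeriodicLoop K L ζ v) : area 0 1 v = L / 2 := by
  rw [area, crossInt]
  congr 1
  have h1 : ∀ t, sympl (∫ s in (0 : ℝ)..t, v s) (v t) = L - sympl (ζ 0) (v t) := fun t => by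
    rw [h.integral_eq, map_sub, sub_apply, h.sympl_eq]
  have hi := h.continuous.intervalIntegrable (μ := volume) 0 1
  simp_rw [h1]
  rw [intervalIntegral.integral_sub intervalIntegrable_const
    ⟨(sympl (ζ 0)).integrable_comp hi.1, (sympl (ζ 0)).integrable_comp hi.2⟩,
    (sympl (ζ 0)).intervalIntegral_comp_comm hi, h.integral_zero_one, map_zero]
  simp

lemma energy_eq (h : IsPeriodicLoop K L ζ v) : energy K v = L ^ 2 := by
  simp [energy, h.suppFun_eq]

end IsPeriodicLoop

/-! ### Symmetrization by rotating pieces -/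

/-- The index `j` with `t ∈ (j / m, (j + 1) / m]`, for positive `t`. -/
noncomputable def pieceIndex (m : ℕ) (t : ℝ) : ℕ := ⌈m * t⌉₊ - 1

/-- The velocity of the curve composed of the successive rotations of the `i`-th of `m` pieces. -/
noncomputable def rotatedPiece {n : ℕ} (m : ℕ) (w : ℂ) (v : ℝ → CSpace n) (i : ℕ) (t : ℝ) :
    CSpace n :=
  w ^ pieceIndex m t • v (t + (i / m - pieceIndex m t / m))

section RotatedPiece

variable {n m : ℕ} {w : ℂ} {v : ℝ → CSpace n}

lemma pieceIndex_eq (hm : 0 < m) {j : ℕ} {t : ℝ} (ht : t ∈ Ioc (j / m : ℝ) ((j + 1 : ℕ) / m)) :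
    pieceIndex m t = j := by
  have hm' : (0 : ℝ) < m := Nat.cast_pos.2 hm
  have h1 : (j : ℝ) < m * t := by
    have := ht.1
    rwa [div_lt_iff₀ hm', mul_comm] at this
  have h2 : m * t ≤ ((j + 1 : ℕ) : ℝ) := by
    have := ht.2
    rwa [le_div_iff₀ hm', mul_comm] at this
  have h3 : ⌈m * t⌉₊ = j + 1 := le_antisymm (Nat.ceil_le.2 h2) (Nat.lt_ceil.2 h1)
  rw [pieceIndex, h3, Nat.add_sub_cancel]

lemma measurable_rotatedPiece (hv : Continuous v) (i : ℕ) :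
    Measurable (rotatedPiece m w v i) := by
  have h1 : Measurable (pieceIndex m) := by
    have : Measurable fun k : ℕ => k - 1 := measurable_from_nat
    exact this.comp (Nat.measurable_ceil.comp (measurable_id.const_mul _))
  have h2 : Measurable fun t : ℝ => w ^ pieceIndex m t :=
    (measurable_from_nat (f := fun k : ℕ => w ^ k)).comp h1
  have h3 : Measurable fun t : ℝ => (pieceIndex m t : ℝ) :=
    (measurable_from_nat (f := fun k : ℕ => (k : ℝ))).comp h1
  exact h2.smul (hv.measurable.comp
    (measurable_id.add ((h3.div_const (m : ℝ)).const_sub _)))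

lemma norm_rotatedPiece (hw : ‖w‖ = 1) (i : ℕ) (t : ℝ) :
    ‖rotatedPiece m w v i t‖ = ‖v (t + (i / m - pieceIndex m t / m))‖ := by
  rw [rotatedPiece, norm_smul, norm_pow, hw, one_pow, one_mul]

lemma rotatedPiece_of_mem (hm : 0 < m) (i : ℕ) {j : ℕ} {t : ℝ}
    (ht : t ∈ Ioc (j / m : ℝ) ((j + 1 : ℕ) / m)) :
    rotatedPiece m w v i t = w ^ j • v (t + (i / m - j / m)) := by
  rw [rotatedPiece, pieceIndex_eq hm ht]

lemma div_le_succ_div (m j : ℕ) : (j / m : ℝ) ≤ ((j + 1 : ℕ) : ℝ) / m := by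
  gcongr
  simp

lemma integral_rotatedPiece (hm : 0 < m) (i j : ℕ) :
    ∫ t in (j / m : ℝ)..((j + 1 : ℕ) / m), rotatedPiece m w v i t
      = w ^ j • ∫ t in (i / m : ℝ)..((i + 1 : ℕ) / m), v t := by
  have h1 : ∫ t in (j / m : ℝ)..((j + 1 : ℕ) / m), rotatedPiece m w v i t
      = ∫ t in (j / m : ℝ)..((j + 1 : ℕ) / m), w ^ j • v (t + (i / m - j / m)) := by
    apply intervalIntegral.integral_congr_ae
    refine ae_of_all _ fun t ht => ?_
    rw [uIoc_of_le (div_le_succ_div m j)] at ht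
    exact rotatedPiece_of_mem hm i ht
  rw [h1, intervalIntegral.integral_smul, intervalIntegral.integral_comp_add_right]
  congr 2
  · ring
  · push_cast
    ring

lemma area_rotatedPiece (hm : 0 < m) (hw : ‖w‖ = 1) (i j : ℕ) :
    area (j / m : ℝ) ((j + 1 : ℕ) / m) (rotatedPiece m w v i)
      = area (i / m : ℝ) ((i + 1 : ℕ) / m) v := by
  rw [area_congr (div_le_succ_div m j)
    (ae_of_all _ fun t ht => rotatedPiece_of_mem (w := w) (v := v) hm i ht),
    area_unit_smul (by rw [norm_pow, hw, one_pow]), area_comp_add_right]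
  congr 1
  · ring
  · push_cast
    ring

end RotatedPiece

section Symmetrization

variable {n m : ℕ} {K : Set (CSpace n)} {L : ℝ} {ζ v : ℝ → CSpace n} {w : ℂ}

lemma exists_mem_Ioc_of_ae {P : ℝ → Prop} (hP : ∀ᵐ t ∂unitVol, P t) {a b : ℝ} (ha : 0 ≤ a)
    (hab : a < b) (hb : b ≤ 1) : ∃ t ∈ Ioc a b, P t := by
  have h1 : ∀ᵐ t ∂volume.restrict (Ioc a b), P t :=
    ae_restrict_of_ae_restrict_of_subset (Ioc_subset_Ioc ha hb) hP
  have h2 : NeBot (ae (volume.restrict (Ioc a b))) := by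
    rw [ae_neBot, Ne, Measure.restrict_eq_zero, Real.volume_Ioc]
    simpa using hab
  obtain ⟨t, ht, ht'⟩ := (h1.and (ae_restrict_mem measurableSet_Ioc)).exists
  exact ⟨t, ht', ht⟩

lemma intervalIntegrable_rotatedPiece (hK : IsSmoothBody K) (h : IsPeriodicLoop K L ζ v)
    (hw : ‖w‖ = 1) (i : ℕ) (a b : ℝ) :
    IntervalIntegrable (rotatedPiece m w v i) volume a b := by
  obtain ⟨C, hC⟩ := h.exists_norm_le hK
  rw [intervalIntegrable_iff]
  refine Measure.integrableOn_of_bounded (M := C) measure_Ioc_lt_top.ne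
    (measurable_rotatedPiece h.continuous i).aestronglyMeasurable (ae_of_all _ fun t => ?_)
  rw [norm_rotatedPiece hw]
  exact hC _

lemma sum_pow_smul_eq_zero (hm : 1 < m) (hw : IsPrimitiveRoot w m) (e : CSpace n) :
    ∑ j ∈ Finset.range m, w ^ j • e = 0 := by
  rw [← Finset.sum_smul, hw.geom_sum_eq_zero hm, zero_smul]

/-- The chords of the composed curve are `w ^ j • e` for one chord `e`, and these sum to zero. -/
lemma isClosedVelocity_rotatedPiece (hK : IsSmoothBody K) (h : IsPeriodicLoop K L ζ v)
    (hm : 1 < m) (hw : IsPrimitiveRoot w m) (i : ℕ) :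
    IsClosedVelocity (rotatedPiece m w v i) := by
  have hw1 : ‖w‖ = 1 := hw.norm'_eq_one (by omega)
  have hm0 : (0 : ℝ) < m := by exact_mod_cast (by omega : 0 < m)
  obtain ⟨C, hC⟩ := h.exists_norm_le hK
  refine ⟨MemLp.of_bound (measurable_rotatedPiece h.continuous i).aestronglyMeasurable C
    (ae_of_all _ fun t => by rw [norm_rotatedPiece hw1]; exact hC _), ?_⟩
  have h1 := intervalIntegral.sum_integral_adjacent_intervals (n := m)
    (a := fun j : ℕ => (j / m : ℝ)) (f := rotatedPiece m w v i) (μ := volume)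
    fun k _ => intervalIntegrable_rotatedPiece hK h hw1 i _ _
  rw [Nat.cast_zero, zero_div, div_self hm0.ne'] at h1
  rw [← h1]
  simp_rw [integral_rotatedPiece (by omega : 0 < m)]
  exact sum_pow_smul_eq_zero hm hw _

lemma energy_rotatedPiece (hK : IsSmoothBody K) (h : IsPeriodicLoop K L ζ v) (hw : ‖w‖ = 1)
    (hwK : w • K = K) (i : ℕ) : energy K (rotatedPiece m w v i) = L ^ 2 := by
  have hpow : ∀ (k : ℕ) (x : CSpace n), suppFun K (w ^ k • x) = suppFun K x := by
    intro k
    induction k with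
    | zero => simp
    | succ k ih => intro x; rw [pow_succ, mul_smul, ih, hK.suppFun_unit_smul hw hwK]
  simp [energy, rotatedPiece, hpow, h.suppFun_eq]

/-- In the sum over `i` each area between a piece and its chord occurs `m` times, as it does on the
left. What remains is a statement on chord polygons, `polygon_symmetrization`. -/
lemma sum_area_rotatedPiece (hK : IsSmoothBody K) (h : IsPeriodicLoop K L ζ v) (hm : 1 < m) :
    m * area 0 1 v ≤ ∑ i ∈ Finset.range m, area 0 1 (rotatedPiece m (rootOfUnity m) v i) := by
  have hw := isPrimitiveRoot_rootOfUnity (m := m) (by omega)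
  set w := rootOfUnity m with hwdef
  have hw1 : ‖w‖ = 1 := hw.norm'_eq_one (by omega)
  have hm0 : (0 : ℝ) < m := by exact_mod_cast (by omega : 0 < m)
  set t : ℕ → ℝ := fun j => (j / m : ℝ) with ht
  have ht0 : t 0 = 0 := by simp [ht]
  have htm : t m = 1 := by simp [ht, hm0.ne']
  set e : ℕ → CSpace n := fun i => ∫ s in t i..t (i + 1), v s with he
  have hvi : ∀ a b, IntervalIntegrable v volume a b := h.continuous.intervalIntegrable
  have hsum : ∑ j ∈ Finset.range m, e j = 0 := by
    rw [intervalIntegral.sum_integral_adjacent_intervals fun k _ => hvi _ _, ht0, htm,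
      h.integral_zero_one]
  have hv := area_eq_sum hvi t m
  rw [ht0, htm] at hv
  have hu : ∀ i, area 0 1 (rotatedPiece m w v i) = m * area (t i) (t (i + 1)) v
      + (∑ j ∈ Finset.range m, sympl (∑ k ∈ Finset.range j, w ^ k • e i) (w ^ j • e i)) / 2 := by
    intro i
    have h1 := area_eq_sum (intervalIntegrable_rotatedPiece hK h hw1 (m := m) i) t m
    rw [ht0, htm] at h1
    have h2 : ∀ j, area (t j) (t (j + 1)) (rotatedPiece m w v i) = area (t i) (t (i + 1)) v :=
      fun j => area_rotatedPiece (by omega) hw1 i j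
    have h3 : ∀ j, ∫ s in t j..t (j + 1), rotatedPiece m w v i s = w ^ j • e i :=
      fun j => integral_rotatedPiece (by omega) i j
    simp_rw [h2, h3] at h1
    rw [h1, Finset.sum_const, Finset.card_range, nsmul_eq_mul]
  have hpoly := polygon_symmetrization hm e hsum
  rw [← hwdef] at hpoly
  simp_rw [hu]
  rw [hv, Finset.sum_add_distrib, ← Finset.mul_sum, ← Finset.sum_div, mul_add]
  linarith

/-- An extremal loop advances by the rotation after the fraction `1 / m` of its period. -/
lemma IsPeriodicLoop.rotate_zero (hK : IsSmoothBody K) (h : IsPeriodicLoop K L ζ v) (hm : 1 < m)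
    (hwK : rootOfUnity m • K = K) (hiso : Isoperimetric K (1 / (2 * L))) :
    ζ (1 / m) = rootOfUnity m • ζ 0 := by
  have hw := isPrimitiveRoot_rootOfUnity (m := m) (by omega)
  have hsum := sum_area_rotatedPiece hK h hm
  set w := rootOfUnity m with hwdef
  have hw1 : ‖w‖ = 1 := hw.norm'_eq_one (by omega)
  have hL := h.pos
  have hm0 : (0 : ℝ) < m := by exact_mod_cast (by omega : 0 < m)
  have hcl := isClosedVelocity_rotatedPiece hK h hm hw
  have hen := energy_rotatedPiece (m := m) hK h hw1 hwK
  have hconst : 1 / (2 * L) * L ^ 2 = L / 2 := by field_simp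
  have hle : ∀ i, area 0 1 (rotatedPiece m w v i) ≤ L / 2 := fun i => by
    have := hiso _ (hcl i)
    rwa [hen, hconst] at this
  -- All areas are at most `L / 2` while their average is at least `L / 2`, so none can be smaller.
  have heq : area 0 1 (rotatedPiece m w v 0) = L / 2 := by
    by_contra hne
    have hlt : ∑ i ∈ Finset.range m, area 0 1 (rotatedPiece m w v i)
        < ∑ i ∈ Finset.range m, L / 2 :=
      Finset.sum_lt_sum (fun i _ => hle i)
        ⟨0, Finset.mem_range.2 (by omega), lt_of_le_of_ne (hle 0) hne⟩
    rw [Finset.sum_const, Finset.card_range, nsmul_eq_mul] at hlt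
    rw [h.area_eq] at hsum
    linarith
  -- The composed curve is extremal, so one constant `c` serves all its pieces. A single good time
  -- in each of the first two pieces suffices: `t₁` yields `c = -ζ 0`, and `t₂` compares this with
  -- the rotated copy.
  obtain ⟨c, hc⟩ := euler_lagrange hK (by positivity) hiso (hcl 0) (by rw [heq, hen, hconst])
  have hcoef : 2 * (1 / (2 * L)) = L⁻¹ := by field_simp
  rw [hcoef] at hc
  have hgrad : ∀ t, L⁻¹ • suppGrad K (v t) = ζ t := fun t => by
    rw [h.suppGrad_eq, inv_smul_smul₀ hL.ne']
  have hm2 : (2 : ℝ) ≤ m := by exact_mod_cast hm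
  have hfirst : ∀ t ∈ Icc (0 : ℝ) (1 / m),
      ∫ s in (0 : ℝ)..t, rotatedPiece m w v 0 s = ζ t - ζ 0 := by
    intro t ht
    rw [← h.integral_eq]
    apply intervalIntegral.integral_congr_ae
    refine ae_of_all _ fun s hs => ?_
    rw [uIoc_of_le ht.1] at hs
    have := rotatedPiece_of_mem (w := w) (v := v) (by omega : 0 < m) 0 (j := 0) (t := s)
      (by simpa using And.intro hs.1 (by simpa using hs.2.trans ht.2))
    simpa using this
  have h1m : 0 < 1 / (m : ℝ) := by positivity
  obtain ⟨t₁, ht₁, hc₁⟩ := exists_mem_Ioc_of_ae hc le_rfl h1m (by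
    rw [div_le_one hm0]
    linarith)
  obtain ⟨t₂, ht₂, hc₂⟩ := exists_mem_Ioc_of_ae hc h1m.le (b := 2 / m) (by gcongr; norm_num) (by
    rw [div_le_one hm0]
    exact hm2)
  have hc0 : c = -ζ 0 := by
    have h1 := rotatedPiece_of_mem (w := w) (v := v) (by omega : 0 < m) 0 (j := 0) (t := t₁)
      (by simpa using ht₁)
    simp only [pow_zero, one_smul, sub_self, add_zero] at h1
    rw [h1, hgrad, hfirst t₁ ⟨ht₁.1.le, ht₁.2⟩, sub_sub, sub_eq_self] at hc₁
    exact (neg_eq_of_add_eq_zero_right hc₁).symm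
  have hmem : ∀ s ∈ Ioc (1 / m : ℝ) t₂, rotatedPiece m w v 0 s = w • v (s - 1 / m) := by
    intro s hs
    have h1 := rotatedPiece_of_mem (w := w) (v := v) (by omega : 0 < m) 0 (j := 1) (t := s)
      ⟨by simpa using hs.1, by
        have := hs.2.trans ht₂.2
        norm_num
        exact this⟩
    rw [h1, pow_one]
    congr 2
    push_cast
    ring
  have hsecond : ∫ s in (1 / m : ℝ)..t₂, rotatedPiece m w v 0 s
      = w • (ζ (t₂ - 1 / m) - ζ 0) := by
    have h1 : ∫ s in (1 / m : ℝ)..t₂, rotatedPiece m w v 0 s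
        = ∫ s in (1 / m : ℝ)..t₂, w • v (s - 1 / m) := by
      apply intervalIntegral.integral_congr_ae
      refine ae_of_all _ fun s hs => hmem s ?_
      rwa [uIoc_of_le ht₂.1.le] at hs
    rw [h1, intervalIntegral.integral_smul, intervalIntegral.integral_comp_sub_right, sub_self,
      h.integral_eq]
  rw [← intervalIntegral.integral_add_adjacent_intervals
    (intervalIntegrable_rotatedPiece hK h hw1 0 0 (1 / m))
    (intervalIntegrable_rotatedPiece hK h hw1 0 (1 / m) t₂),
    hfirst (1 / m) ⟨h1m.le, le_rfl⟩, hsecond, hc0, hmem t₂ ⟨ht₂.1, le_rfl⟩,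
    hK.suppGrad_unit_smul hw1 hwK, smul_comm, hgrad, smul_sub] at hc₂
  -- After cancelling `w • ζ (t₂ - 1 / m)`, only the two values at the junction are left.
  have h3 : ζ (1 / m) - w • ζ 0 = 0 := by
    rw [← sub_eq_zero] at hc₂
    rw [← hc₂]
    abel
  exact sub_eq_zero.1 h3

lemma IsPeriodicLoop.rotate (hK : IsSmoothBody K) (h : IsPeriodicLoop K L ζ v) (hm : 1 < m)
    (hwK : rootOfUnity m • K = K) (hiso : Isoperimetric K (1 / (2 * L))) (t : ℝ) :
    ζ (t + 1 / m) = rootOfUnity m • ζ t := by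
  have := (h.shift t).rotate_zero hK hm hwK hiso
  simpa only [zero_add, add_comm t] using this

end Symmetrization

/-! ### Conclusion -/

lemma pow_smul_set_eq {n : ℕ} {w : ℂ} {S : Set (CSpace n)} (h : w • S = S) (k : ℕ) :
    w ^ k • S = S := by
  induction k with
  | zero => simp
  | succ k ih => rw [pow_succ, mul_smul, h, ih]

/-- The origin is the barycenter of the orbit of any interior point, because the powers of `w` sum
to zero. -/
lemma zero_mem_interior_of_rotation {n m : ℕ} (hm : 1 < m) {w : ℂ} (hw : IsPrimitiveRoot w m)
    {K : Set (CSpace n)} (hconv : Convex ℝ K) (hint : (interior K).Nonempty) (hwK : w • K = K) :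
    (0 : CSpace n) ∈ interior K := by
  obtain ⟨x, hx⟩ := hint
  have hw0 : w ≠ 0 := hw.ne_zero (by omega)
  have hwi : w • interior K = interior K := by rw [← interior_smul₀ hw0, hwK]
  have hm0 : (m : ℝ) ≠ 0 := by exact_mod_cast (by omega : m ≠ 0)
  have h1 := hconv.interior.sum_mem (t := Finset.range m) (w := fun _ => (m : ℝ)⁻¹)
    (z := fun j => w ^ j • x) (fun _ _ => by positivity) (by simp [hm0]) (fun j _ => by
      have := smul_mem_smul_set (a := w ^ j) hx
      rwa [pow_smul_set_eq hwi] at this)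
  rwa [← Finset.smul_sum, sum_pow_smul_eq_zero hm hw, smul_zero] at h1

/-- A minimal closed characteristic is invariant under the smallest rotation preserving the
body. -/
theorem IsMinimalClosedCharacteristic.rotation_invariant {n m : ℕ} (hm : 1 < m)
    {K : Set (CSpace n)} (hK : IsSmoothBody K) (hsmooth : HasSmoothBoundary K)
    (hwK : rootOfUnity m • K = K) {T : ℝ} {γ : ℝ → CSpace n}
    (hγ : IsMinimalClosedCharacteristic K T γ) :
    rootOfUnity m • (γ '' Icc 0 T) = γ '' Icc 0 T := by
  obtain ⟨η, d, hloop, himg, hlen⟩ := hγ.1.exists_posLoop hK hsmooth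
  obtain ⟨ζ, v, hper, himg'⟩ := hloop.exists_periodicLoop hK
  rw [hlen] at hper
  set L := 2 * |action T γ| with hLdef
  have hL := hper.pos
  have hv := hper.isClosedVelocity hK
  obtain ⟨a, ha, hiso, u, hu, hu0, hueq, huen⟩ := exists_isoperimetric hK hv.memLp
    hv.integral_eq_zero (by rw [hper.area_eq]; positivity)
  have hiso' : Isoperimetric K a := fun u hu => hiso u hu.memLp hu.integral_eq_zero
  obtain ⟨η₁, d₁, hloop₁, hlen₁⟩ := exists_posLoop_of_extremal hK ha hiso' ⟨hu, hu0⟩ hueq huen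
  -- Minimality against the characteristic built from the extremal gives `L ≤ 1 / (2a)`. The
  -- isoperimetric inequality for the curve itself gives `1 ≤ 2aL`. Hence `a = 1 / (2L)`, and the
  -- curve is extremal.
  have hmin := hγ.2 1 η₁ (hloop₁.isClosedCharacteristic hK hsmooth)
  rw [hloop₁.action_eq_half_length, hlen₁,
    abs_of_pos (show 0 < 1 / (2 * a) / 2 by positivity)] at hmin
  have h1 := hiso' v hv
  rw [hper.area_eq, hper.energy_eq] at h1
  have h2 : L ≤ 1 / (2 * a) := by linarith
  have h3 : L * (2 * a) ≤ 1 := (le_div_iff₀ (by positivity)).1 h2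
  have h4 : 1 ≤ a * L * 2 := by
    have h5 : L * 1 ≤ L * (a * L * 2) := by linarith
    exact le_of_mul_le_mul_left h5 hL
  have haL : a = 1 / (2 * L) := by
    rw [eq_div_iff (by positivity)]
    linarith
  rw [haL] at hiso'
  have hrot := hper.rotate hK hm hwK hiso'
  have hrange : γ '' Icc 0 T = range ζ := by
    rw [← himg, ← himg', ← hper.periodic.image_Icc one_pos 0, zero_add]
  rw [hrange]
  ext x
  constructor
  · rintro ⟨_, ⟨t, rfl⟩, rfl⟩
    exact ⟨t + 1 / m, hrot t⟩
  · rintro ⟨t, rfl⟩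
    refine ⟨ζ (t - 1 / m), ⟨_, rfl⟩, ?_⟩
    have := hrot (t - 1 / m)
    rw [sub_add_cancel] at this
    exact this.symm

theorem theorem4 (n m : ℕ) (hm : 0 < m) (w : ℂ) (hw : IsPrimitiveRoot w m)
    (K : Set (EuclideanSpace ℂ (Fin n))) (hcompact : IsCompact K)
    (hinterior : (interior K).Nonempty) (hconvex : StrictConvex ℝ K)
    (hsmooth : HasSmoothBoundary K) (hsymm : w • K = K)
    (T : ℝ) (γ : ℝ → EuclideanSpace ℂ (Fin n))
    (hγ : IsMinimalClosedCharacteristic K T γ) :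
    w • (γ '' Icc 0 T) = γ '' Icc 0 T := by
  rcases Nat.lt_or_ge 1 m with hm1 | hm1
  · have hK := isSmoothBody_of_hasSmoothBoundary hcompact hconvex hsmooth
      (zero_mem_interior_of_rotation hm1 hw hconvex.convex hinterior hsymm)
    have hroot := isPrimitiveRoot_rootOfUnity hm.ne'
    have : NeZero m := ⟨hm.ne'⟩
    -- The given root and `exp(2πi/m)` are powers of each other: invariance of `K` passes to the
    -- latter, and invariance of the curve passes back.
    obtain ⟨k, -, hk⟩ := hw.eq_pow_of_pow_eq_one hroot.pow_eq_one
    obtain ⟨j, -, hj⟩ := hroot.eq_pow_of_pow_eq_one hw.pow_eq_one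
    have hrot := hγ.rotation_invariant hm1 hK hsmooth (by rw [← hk]; exact pow_smul_set_eq hsymm k)
    rw [← hj]
    exact pow_smul_set_eq hrot j
  · have h1 : m = 1 := by omega
    rw [h1, IsPrimitiveRoot.one_right_iff] at hw
    rw [hw, one_smul]
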